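/- An instance of General Position Subset Selection is a pair $(P,k)$ of a finite set $P$ of points in the plane with rational coordinates and $k\in\mathbb{N}$; it is a yes-instance if some $S\subseteq P$ with $|S|\ge k$ is in general position, i.e. contains no three distinct collinear points. Put $n=|P|$ and $h=n-k\in\mathbb{Z}$. **Theorem.** General Position Subset Selection has a problem kernel with at most $2h^2+h$ points that is computable in $O(n^2)$ time. That is, there is an algorithm which maps every instance $(P,k)$ to an instance $(P',k')$ such that 1. $(P,k)$ is a yes-instance if and only if $(P',k')$ is a yes-instance; 2. $P'\subseteq P$, $|P'|\le 2h^2+h$ and $k'\le 2h^2+h+1$; 3. the algorithm takes $O(n^2)$ steps. Here an algorithm is one fixed program for the random access machine with integer words, indirect addressing, unit-cost integer operations $+,-,\times,\div$ and sign tests; the coordinates are given as fractions of integers. If all numbers in the input (numerators, denominators, $n$ and $k$) have at most $b$ bits, the program uses only words and addresses of $O(b+1)$ bits; the constants in both $O$-terms are absolute. -/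

import Mathlib

namespace GPSS

/-! ### The problem -/

/-- No three distinct points of `S` lie on a common line. -/
def InGeneralPosition (S : Finset (ℚ × ℚ)) : Prop :=
  ∀ p ∈ S, ∀ q ∈ S, ∀ r ∈ S, p ≠ q → p ≠ r → q ≠ r →
    ¬ Collinear ℚ ({p, q, r} : Set (ℚ × ℚ))

/-- `(P, k)` is a yes-instance of General Position Subset Selection. -/
def IsYes (P : Finset (ℚ × ℚ)) (k : ℕ) : Prop :=
  ∃ S ⊆ P, InGeneralPosition S ∧ k ≤ S.card

/-- The dual parameter `n - k`, as an integer (it is negative if `k > n`). -/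
def dualParam (P : Finset (ℚ × ℚ)) (k : ℕ) : ℤ := (P.card : ℤ) - (k : ℤ)

/-! ### The machine model: a random access machine with integer words of bounded length -/

/-- Memory: every address holds one integer word. -/
abbrev Mem := ℤ → ℤ

/-- Arithmetic expressions; `load e` is the content of the cell whose address is the value of `e`
(indirect addressing). -/
inductive Expr : Type
  | const (c : ℤ) : Expr
  | load (e : Expr) : Expr
  | add (e f : Expr) : Expr
  | sub (e f : Expr) : Expr
  | mul (e f : Expr) : Expr
  | div (e f : Expr) : Expr

/-- Value of an expression. The quotient is the Euclidean integer quotient, with `x / 0 = 0`. -/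
def Expr.eval (m : Mem) : Expr → ℤ
  | .const c => c
  | .load e => m (e.eval m)
  | .add e f => e.eval m + f.eval m
  | .sub e f => e.eval m - f.eval m
  | .mul e f => e.eval m * f.eval m
  | .div e f => e.eval m / f.eval m

/-- Number of unit-cost operations spent on evaluating an expression. -/
def Expr.cost : Expr → ℕ
  | .const _ => 1
  | .load e => e.cost + 1
  | .add e f => e.cost + f.cost + 1
  | .sub e f => e.cost + f.cost + 1
  | .mul e f => e.cost + f.cost + 1
  | .div e f => e.cost + f.cost + 1

/-- The integer `v` fits into a word of `w` bits and a sign. -/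
def FitsWord (w : ℕ) (v : ℤ) : Prop := |v| < 2 ^ w

/-- All values that occur when the expression is evaluated (hence also all addresses that are used)
fit into words of length `w`. -/
def Expr.Fits (w : ℕ) (m : Mem) : Expr → Prop
  | .const c => FitsWord w c
  | .load e => e.Fits w m ∧ FitsWord w (m (e.eval m))
  | .add e f => e.Fits w m ∧ f.Fits w m ∧ FitsWord w (e.eval m + f.eval m)
  | .sub e f => e.Fits w m ∧ f.Fits w m ∧ FitsWord w (e.eval m - f.eval m)
  | .mul e f => e.Fits w m ∧ f.Fits w m ∧ FitsWord w (e.eval m * f.eval m)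
  | .div e f => e.Fits w m ∧ f.Fits w m ∧ FitsWord w (e.eval m / f.eval m)

/-- Programs. `store a e` writes the value of `e` into the cell whose address is the value of `a`;
`ite e c d` runs `c` if the value of `e` is positive, and `d` otherwise;
`loop e c` repeats `c` as long as the value of `e` is positive. -/
inductive Program : Type
  | skip : Program
  | store (a e : Expr) : Program
  | seq (c d : Program) : Program
  | ite (e : Expr) (c d : Program) : Program
  | loop (e : Expr) (c : Program) : Program

/-- `Exec w c m t m'`: on the machine with words of length `w`, program `c` started on memory `m`
halts after `t` steps with memory `m'`. A run in which some value does not fit into a word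
has no result. -/
inductive Exec (w : ℕ) : Program → Mem → ℕ → Mem → Prop
  | skip (m : Mem) : Exec w .skip m 1 m
  | store (a e : Expr) (m : Mem) : a.Fits w m → e.Fits w m →
      Exec w (.store a e) m (a.cost + e.cost + 1) (Function.update m (a.eval m) (e.eval m))
  | seq (c d : Program) (m₀ m₁ m₂ : Mem) (t₁ t₂ : ℕ) :
      Exec w c m₀ t₁ m₁ → Exec w d m₁ t₂ m₂ → Exec w (.seq c d) m₀ (t₁ + t₂) m₂
  | ite_pos (e : Expr) (c d : Program) (m m₁ : Mem) (t : ℕ) : e.Fits w m → 0 < e.eval m →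
      Exec w c m t m₁ → Exec w (.ite e c d) m (e.cost + 1 + t) m₁
  | ite_neg (e : Expr) (c d : Program) (m m₁ : Mem) (t : ℕ) : e.Fits w m → e.eval m ≤ 0 →
      Exec w d m t m₁ → Exec w (.ite e c d) m (e.cost + 1 + t) m₁
  | loop_done (e : Expr) (c : Program) (m : Mem) : e.Fits w m → e.eval m ≤ 0 →
      Exec w (.loop e c) m (e.cost + 1) m
  | loop_step (e : Expr) (c : Program) (m₀ m₁ m₂ : Mem) (t₁ t₂ : ℕ) : e.Fits w m₀ →
      0 < e.eval m₀ → Exec w c m₀ t₁ m₁ → Exec w (.loop e c) m₁ t₂ m₂ →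
      Exec w (.loop e c) m₀ (e.cost + 1 + t₁ + t₂) m₂

/-! ### Instances in memory -/

/-- The memory `m` holds the instance `(P, k)`: cell `0` contains the number of points, cell `1`
contains `k`, and the points of `P`, in some order and each exactly once, are stored from
cell `2` on, four cells per point: numerator and denominator of the first coordinate, numerator and
denominator of the second one (denominators are positive, fractions need not be reduced). -/
def Encodes (m : Mem) (P : Finset (ℚ × ℚ)) (k : ℕ) : Prop :=
  ∃ L : List (ℚ × ℚ), L.Nodup ∧ L.toFinset = P ∧
    m 0 = (L.length : ℤ) ∧ m 1 = (k : ℤ) ∧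
    ∀ (i : ℕ) (hi : i < L.length),
      0 < m (4 * (i : ℤ) + 3) ∧ 0 < m (4 * (i : ℤ) + 5) ∧
      L[i] = ((m (4 * (i : ℤ) + 2) : ℚ) / (m (4 * (i : ℤ) + 3) : ℚ),
              (m (4 * (i : ℤ) + 4) : ℚ) / (m (4 * (i : ℤ) + 5) : ℚ))

/-- An initial memory for the instance `(P, k)`: all cells outside the encoding are zero. -/
def IsInput (m : Mem) (P : Finset (ℚ × ℚ)) (k : ℕ) : Prop :=
  Encodes m P k ∧ ∀ a : ℤ, (a < 0 ∨ 4 * (P.card : ℤ) + 2 ≤ a) → m a = 0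

end GPSS

/-!
# A quadratic kernel for General Position Subset Selection

Fix an instance `(P, k)` with `h = n - k ≥ 0`; a solution arises by deleting at most `h` points.
For a point `p` of a finite set `Q`, let `weight Q p` be the sum of `|ℓ ∩ Q| - 2` over the lines
`ℓ` that join `p` to another point of `Q`. A solution that keeps `p` deletes at least `weight P p`
other points, so points with `weight P p > h` have to be deleted (`isYes_light_iff`). In the set
`Q` of the remaining points, those of weight `0` lie in no collinear triple; they can be moved
into the solution, with `k` decreased accordingly (`isYes_core_iff`). Let `core Q` be what is
left. Each of its points that a solution keeps lies in a collinear triple of `core Q`, hence on a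
line with one of the at most `h` deleted points and a third point. As a line with `c ≥ 3` points
contributes `c - 2 ≥ (c - 1) / 2` to the weight, every deleted point shares such lines with at
most `2 h` points. Therefore a yes-instance has at most `h + 2 h ^ 2` points in its core
(`card_core_le`), and otherwise a constant no-instance may be returned.

The weight of `p` is the number of further points minus the number of directions in which they are
seen. To count the directions in constant time per pair, without sorting or computing greatest
common divisors, the program uses direct addressing: the integer part of `(U / V) * B ^ 2`, for a
bound `B` on all numerators `U` and denominators `V`, determines the slope (`slopeKey_eq_iff`) and
has only `O(b + 1)` bits, so that it may serve as the address of a table cell; vertical lines get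
a separate cell. A cell counts as occupied if it carries the stamp of the current row; stamps
increase, so the table is never cleared. Two scans (`runs_scan`) yield the two kinds of weight,
and a final sweep (`runs_compact`) moves the kernel to the front.

Programs are verified with total-correctness rules (`Runs`). All words in memory stay below
`memBound b`, a power of `2 ^ (b + 1)`. The value of an expression is then bounded by a power of
`memBound b` whose exponent is the number of its leaves, so that the word length required by the
machine reduces to the decidable property `Expr.Simple`.
-/

namespace GPSS

/-! ### Directions and weights -/

/-- The direction of the line through `p` and `q`: its slope, or `none` for a vertical line.
Meaningful for `q ≠ p` only. -/
def dir (p q : ℚ × ℚ) : Option ℚ :=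
  if q.1 - p.1 = 0 then none else some ((q.2 - p.2) / (q.1 - p.1))

/-- The number of points of `Q` other than `p` in excess of one per line through `p`. When `p ∈ Q`
this is the sum of `|ℓ ∩ Q| - 2` over the lines `ℓ` through `p` and another point of `Q`. -/
def weight (Q : Finset (ℚ × ℚ)) (p : ℚ × ℚ) : ℕ :=
  (Q.erase p).card - ((Q.erase p).image (dir p)).card

theorem dir_eq_dir_iff {p q r : ℚ × ℚ} (hq : q ≠ p) (hr : r ≠ p) :
    dir p q = dir p r ↔ (q.1 - p.1) * (r.2 - p.2) = (r.1 - p.1) * (q.2 - p.2) := by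
  have nz : ∀ s : ℚ × ℚ, s ≠ p → s.1 - p.1 = 0 → s.2 - p.2 ≠ 0 := fun s hs h1 h2 =>
    hs (Prod.ext (sub_eq_zero.mp h1) (sub_eq_zero.mp h2))
  unfold dir
  by_cases h1 : q.1 - p.1 = 0 <;> by_cases h2 : r.1 - p.1 = 0
  · simp [h1, h2]
  · simp [h1, h2, nz q hq h1]
  · simp [h1, h2, nz r hr h2]
  · simp only [h1, h2, if_false, Option.some.injEq]
    rw [div_eq_div_iff h1 h2]
    constructor <;> intro h <;> linarith

theorem collinear_triple_iff {p q r : ℚ × ℚ} (hq : q ≠ p) :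
    Collinear ℚ ({p, q, r} : Set (ℚ × ℚ)) ↔
      (q.1 - p.1) * (r.2 - p.2) = (r.1 - p.1) * (q.2 - p.2) := by
  rw [collinear_iff_of_mem (p₀ := p) (by simp)]
  constructor
  · rintro ⟨v, hv⟩
    obtain ⟨s, rfl⟩ := hv q (by simp)
    obtain ⟨t, rfl⟩ := hv r (by simp)
    simp
    ring
  · intro h
    refine ⟨q - p, ?_⟩
    simp only [Set.mem_insert_iff, Set.mem_singleton_iff, forall_eq_or_imp, forall_eq]
    refine ⟨⟨0, by simp⟩, ⟨1, by simp⟩, ?_⟩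
    by_cases h1 : q.1 - p.1 = 0
    · have h2 : q.2 - p.2 ≠ 0 := fun h2 =>
        hq (Prod.ext (sub_eq_zero.mp h1) (sub_eq_zero.mp h2))
      have h3 : r.1 - p.1 = 0 := by
        rw [h1, zero_mul] at h
        exact (mul_eq_zero.mp h.symm).resolve_right h2
      refine ⟨(r.2 - p.2) / (q.2 - p.2), Prod.ext ?_ ?_⟩
      · simp [h1]; linarith
      · simp [div_mul_cancel₀ _ h2]
    · refine ⟨(r.1 - p.1) / (q.1 - p.1), Prod.ext ?_ ?_⟩
      · simp [div_mul_cancel₀ _ h1]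
      · have : (r.1 - p.1) / (q.1 - p.1) * (q.2 - p.2) = r.2 - p.2 := by
          rw [div_mul_eq_mul_div, div_eq_iff h1]; linarith
        simp [this]

theorem collinear_iff_dir {p q r : ℚ × ℚ} (hq : q ≠ p) (hr : r ≠ p) :
    Collinear ℚ ({p, q, r} : Set (ℚ × ℚ)) ↔ dir p q = dir p r := by
  rw [collinear_triple_iff hq, dir_eq_dir_iff hq hr]

theorem dir_rotate {p q r : ℚ × ℚ} (hpq : p ≠ q) (hpr : p ≠ r) (hqr : q ≠ r)
    (h : dir p q = dir p r) : dir q p = dir q r := by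
  rw [dir_eq_dir_iff hpq.symm hpr.symm] at h
  rw [dir_eq_dir_iff hpq hqr.symm]
  linarith

theorem InGeneralPosition.dir_injOn {S : Finset (ℚ × ℚ)} (hS : InGeneralPosition S)
    {p : ℚ × ℚ} (hp : p ∈ S) : Set.InjOn (dir p) (S.erase p : Finset (ℚ × ℚ)) := by
  intro q hq r hr h
  rw [Finset.mem_coe, Finset.mem_erase] at hq hr
  by_contra hqr
  exact hS p hp q hq.2 r hr.2 hq.1.symm hr.1.symm hqr ((collinear_iff_dir hq.1 hr.1).mpr h)

/-- A point of a solution `S` forces the deletion of all but one of the further points on each line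
through it. -/
theorem weight_add_card_le {Q S : Finset (ℚ × ℚ)} (hSQ : S ⊆ Q) (hS : InGeneralPosition S)
    {p : ℚ × ℚ} (hp : p ∈ S) : weight Q p + S.card ≤ Q.card := by
  have h1 : (S.erase p).card ≤ ((Q.erase p).image (dir p)).card := by
    rw [← Finset.card_image_of_injOn (hS.dir_injOn hp)]
    exact Finset.card_le_card (Finset.image_subset_image (Finset.erase_subset_erase p hSQ))
  have h2 : ((Q.erase p).image (dir p)).card ≤ (Q.erase p).card := Finset.card_image_le
  have h3 := Finset.card_erase_add_one hp
  have h4 := Finset.card_erase_add_one (hSQ hp)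
  unfold weight
  omega

theorem weight_eq_zero_iff {Q : Finset (ℚ × ℚ)} {p : ℚ × ℚ} :
    weight Q p = 0 ↔ Set.InjOn (dir p) (Q.erase p : Finset (ℚ × ℚ)) := by
  rw [← Finset.card_image_iff, weight]
  have h2 : ((Q.erase p).image (dir p)).card ≤ (Q.erase p).card := Finset.card_image_le
  omega

theorem weight_pos_of_dir_eq {Q : Finset (ℚ × ℚ)} {p q r : ℚ × ℚ} (hq : q ∈ Q) (hr : r ∈ Q)
    (hqp : q ≠ p) (hrp : r ≠ p) (hqr : q ≠ r) (h : dir p q = dir p r) : 0 < weight Q p := by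
  rw [Nat.pos_iff_ne_zero, Ne, weight_eq_zero_iff]
  intro hinj
  exact hqr (hinj (by simp [hq, hqp]) (by simp [hr, hrp]) h)

/-- The points of `Q` that lie on a common line with `p` and a third point of `Q`. -/
def conflicts (Q : Finset (ℚ × ℚ)) (p : ℚ × ℚ) : Finset (ℚ × ℚ) :=
  (Q.erase p).filter fun q => ∃ r ∈ Q.erase p, r ≠ q ∧ dir p r = dir p q

/-- A line with `|ℓ ∩ Q| ≥ 3` contains `|ℓ ∩ Q| - 1 ≤ 2 (|ℓ ∩ Q| - 2)` points besides `p`. -/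
theorem card_conflicts_le (Q : Finset (ℚ × ℚ)) (p : ℚ × ℚ) :
    (conflicts Q p).card ≤ 2 * weight Q p := by
  set E := Q.erase p with hE
  set N := conflicts Q p with hN
  have hNE : N ⊆ E := Finset.filter_subset _ _
  have h1 : 2 * (N.image (dir p)).card ≤ N.card := by
    refine Finset.mul_card_image_le_card _ 2 ?_
    intro d hd
    obtain ⟨q, hq, rfl⟩ := Finset.mem_image.mp hd
    obtain ⟨hqE, r, hrE, hrq, hdr⟩ := Finset.mem_filter.mp hq
    have hrN : r ∈ N := Finset.mem_filter.mpr ⟨hrE, q, hqE, hrq.symm, hdr.symm⟩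
    rw [← Finset.card_pair (a := r) (b := q) hrq]
    refine Finset.card_le_card ?_
    intro x hx
    rcases Finset.mem_insert.mp hx with rfl | hx
    · exact Finset.mem_filter.mpr ⟨hrN, hdr⟩
    · rw [Finset.mem_singleton] at hx
      subst hx
      exact Finset.mem_filter.mpr ⟨hq, rfl⟩
  have h2 : (E.image (dir p)).card ≤ (N.image (dir p)).card + (E \ N).card := by
    calc (E.image (dir p)).card = ((N ∪ E \ N).image (dir p)).card := by
          rw [Finset.union_sdiff_of_subset hNE]
      _ ≤ (N.image (dir p)).card + ((E \ N).image (dir p)).card := by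
          rw [Finset.image_union]; exact Finset.card_union_le _ _
      _ ≤ _ := Nat.add_le_add_left Finset.card_image_le _
  have h3 : (E \ N).card + N.card = E.card := Finset.card_sdiff_add_card_eq_card hNE
  unfold weight
  rw [← hE]
  omega

/-! ### The reduction -/

/-- The points of `P` of weight at most `h`. The others belong to every deletion set with at most
`h` points that leaves a set in general position. -/
def light (P : Finset (ℚ × ℚ)) (h : ℤ) : Finset (ℚ × ℚ) :=
  P.filter fun p => (weight P p : ℤ) ≤ h

/-- The points of `Q` that lie on no line with two further points of `Q`. -/
def free (Q : Finset (ℚ × ℚ)) : Finset (ℚ × ℚ) := Q.filter fun p => weight Q p = 0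

/-- The points of `Q` that lie on a line with two further points of `Q`. -/
def core (Q : Finset (ℚ × ℚ)) : Finset (ℚ × ℚ) := Q.filter fun p => 0 < weight Q p

theorem card_free_add_card_core (Q : Finset (ℚ × ℚ)) :
    (free Q).card + (core Q).card = Q.card := by
  have := Finset.card_filter_add_card_filter_not (s := Q) (fun p => weight Q p = 0)
  simpa only [free, core, Nat.pos_iff_ne_zero] using this

theorem InGeneralPosition.mono {S S' : Finset (ℚ × ℚ)} (h : S ⊆ S') (hS : InGeneralPosition S') :
    InGeneralPosition S :=
  fun p hp q hq r hr => hS p (h hp) q (h hq) r (h hr)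

/-- Heavy points belong to no solution. -/
theorem isYes_light_iff (P : Finset (ℚ × ℚ)) (k : ℕ) :
    IsYes P k ↔ IsYes (light P (dualParam P k)) k := by
  constructor
  · rintro ⟨S, hSP, hS, hk⟩
    refine ⟨S, fun p hp => Finset.mem_filter.mpr ⟨hSP hp, ?_⟩, hS, hk⟩
    have := weight_add_card_le hSP hS hp
    unfold dualParam
    omega
  · rintro ⟨S, hSP, hS⟩
    exact ⟨S, hSP.trans (Finset.filter_subset _ _), hS⟩

theorem not_dir_eq_of_mem_free {Q : Finset (ℚ × ℚ)} {p q r : ℚ × ℚ} (hp : p ∈ free Q)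
    (hq : q ∈ Q) (hr : r ∈ Q) (hqp : q ≠ p) (hrp : r ≠ p) (hqr : q ≠ r) : dir p q ≠ dir p r := by
  intro h
  have := weight_pos_of_dir_eq hq hr hqp hrp hqr h
  have := (Finset.mem_filter.mp hp).2
  omega

/-- Free points can be added to any solution. If `k` is at most their number, both sides hold, in
accordance with the truncated subtraction. -/
theorem isYes_core_iff (Q : Finset (ℚ × ℚ)) (k : ℕ) :
    IsYes Q k ↔ IsYes (core Q) (k - (free Q).card) := by
  constructor
  · rintro ⟨S, hSQ, hS, hk⟩
    refine ⟨S \ free Q, ?_, hS.mono Finset.sdiff_subset, ?_⟩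
    · intro p hp
      obtain ⟨hpS, hpF⟩ := Finset.mem_sdiff.mp hp
      refine Finset.mem_filter.mpr ⟨hSQ hpS, Nat.pos_of_ne_zero fun h0 => hpF ?_⟩
      exact Finset.mem_filter.mpr ⟨hSQ hpS, h0⟩
    · have := Finset.le_card_sdiff (free Q) S
      omega
  · rintro ⟨S, hSQ, hS, hk⟩
    have hdisj : Disjoint S (free Q) := by
      rw [Finset.disjoint_left]
      intro p hp hpF
      have h1 := (Finset.mem_filter.mp (hSQ hp)).2
      have h2 := (Finset.mem_filter.mp hpF).2
      omega
    have hsub : S ∪ free Q ⊆ Q :=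
      Finset.union_subset (hSQ.trans (Finset.filter_subset _ _)) (Finset.filter_subset _ _)
    refine ⟨S ∪ free Q, hsub, ?_, ?_⟩
    · intro p hp q hq r hr hpq hpr hqr hcol
      have hd : dir p q = dir p r := (collinear_iff_dir hpq.symm hpr.symm).mp hcol
      -- A free point cannot be any of the three points, so all of them lie in `S`.
      have hpS : p ∈ S := (Finset.mem_union.mp hp).resolve_right fun hf =>
        not_dir_eq_of_mem_free hf (hsub hq) (hsub hr) hpq.symm hpr.symm hqr hd
      have hqS : q ∈ S := (Finset.mem_union.mp hq).resolve_right fun hf =>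
        not_dir_eq_of_mem_free hf (hsub hp) (hsub hr) hpq hqr.symm hpr (dir_rotate hpq hpr hqr hd)
      have hrS : r ∈ S := (Finset.mem_union.mp hr).resolve_right fun hf =>
        not_dir_eq_of_mem_free hf (hsub hp) (hsub hq) hpr hqr hpq
          (dir_rotate hpr hpq hqr.symm hd.symm)
      exact hS p hpS q hqS r hrS hpq hpr hqr hcol
    · rw [Finset.card_union_of_disjoint hdisj]
      omega

/-- Every kept point of the core shares a line with a deleted one, and a light point has at most
`2 h` conflicts. -/
theorem card_core_le {P : Finset (ℚ × ℚ)} {k : ℕ}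
    (hyes : IsYes (core (light P (dualParam P k)))
      (k - (free (light P (dualParam P k))).card)) :
    ((core (light P (dualParam P k))).card : ℤ) ≤ 2 * dualParam P k ^ 2 + dualParam P k := by
  set h := dualParam P k with hh
  set Q := light P h with hQ
  obtain ⟨S, hSC, hS, hk⟩ := hyes
  have hQP : Q ⊆ P := Finset.filter_subset _ _
  have hCQ : core Q ⊆ Q := Finset.filter_subset _ _
  set D := core Q \ S with hD
  have hDcard : D.card + S.card = (core Q).card := Finset.card_sdiff_add_card_eq_card hSC
  have hsum := card_free_add_card_core Q
  have hQPc := Finset.card_le_card hQP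
  have hDh : (D.card : ℤ) ≤ h := by
    rw [hh]; unfold dualParam; omega
  have hcover : core Q ⊆ D ∪ D.biUnion (conflicts P) := by
    intro q hq
    by_cases hqS : q ∈ S
    swap
    · exact Finset.mem_union_left _ (Finset.mem_sdiff.mpr ⟨hq, hqS⟩)
    obtain ⟨hqQ, hqw⟩ := Finset.mem_filter.mp hq
    have hni : ¬ Set.InjOn (dir q) (Q.erase q : Finset (ℚ × ℚ)) := by
      rw [← weight_eq_zero_iff]; omega
    simp only [Set.InjOn, not_forall, Finset.mem_coe, Finset.mem_erase] at hni
    obtain ⟨r, ⟨hrq, hrQ⟩, r', ⟨hrq', hrQ'⟩, hd, hrr⟩ := hni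
    have hd1 : dir r q = dir r r' := dir_rotate hrq.symm hrq'.symm hrr hd
    have hd2 : dir r' q = dir r' r := dir_rotate hrq'.symm hrq.symm (Ne.symm hrr) hd.symm
    have hr : r ∈ core Q := Finset.mem_filter.mpr
      ⟨hrQ, weight_pos_of_dir_eq hqQ hrQ' hrq.symm (Ne.symm hrr) hrq'.symm hd1⟩
    have hr' : r' ∈ core Q := Finset.mem_filter.mpr
      ⟨hrQ', weight_pos_of_dir_eq hqQ hrQ hrq'.symm hrr hrq.symm hd2⟩
    refine Finset.mem_union_right _ (Finset.mem_biUnion.mpr ?_)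
    by_cases hrS : r ∈ S
    · have hrS' : r' ∉ S := fun hrS' => hS q hqS r hrS r' hrS' hrq.symm hrq'.symm hrr
        ((collinear_iff_dir hrq hrq').mpr hd)
      exact ⟨r', Finset.mem_sdiff.mpr ⟨hr', hrS'⟩, Finset.mem_filter.mpr
        ⟨Finset.mem_erase.mpr ⟨hrq'.symm, hQP hqQ⟩, r,
          Finset.mem_erase.mpr ⟨hrr, hQP hrQ⟩, hrq, hd2.symm⟩⟩
    · exact ⟨r, Finset.mem_sdiff.mpr ⟨hr, hrS⟩, Finset.mem_filter.mpr
        ⟨Finset.mem_erase.mpr ⟨hrq.symm, hQP hqQ⟩, r',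
          Finset.mem_erase.mpr ⟨Ne.symm hrr, hQP hrQ'⟩, hrq', hd1.symm⟩⟩
  have hbound : ∀ d ∈ D, (conflicts P d).card ≤ 2 * h.toNat := by
    intro d hd
    have h1 := card_conflicts_le P d
    have h2 := (Finset.mem_filter.mp (hCQ (Finset.sdiff_subset hd))).2
    omega
  have h1 := Finset.card_le_card hcover
  have h2 := Finset.card_union_le D (D.biUnion (conflicts P))
  have h3 := Finset.card_biUnion_le_card_mul D (conflicts P) _ hbound
  have h0 : 0 ≤ h := le_trans (Int.natCast_nonneg _) hDh
  have h4 : ((core Q).card : ℤ) ≤ D.card + D.card * (2 * h) := by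
    have : (core Q).card ≤ D.card + D.card * (2 * h.toNat) := by omega
    have h5 : ((core Q).card : ℤ) ≤ D.card + D.card * (2 * (h.toNat : ℤ)) := by exact_mod_cast this
    rwa [Int.toNat_of_nonneg h0] at h5
  nlinarith

/-! ### Programs on bounded memories -/

instance (n : ℕ) [OfNat ℤ n] : OfNat Expr n := ⟨.const (OfNat.ofNat n)⟩
instance : Add Expr := ⟨.add⟩
instance : Sub Expr := ⟨.sub⟩
instance : Mul Expr := ⟨.mul⟩
instance : Div Expr := ⟨.div⟩

namespace Expr

@[simp] theorem eval_ofNat (m : Mem) (n : ℕ) [OfNat ℤ n] :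
    (ofNat(n) : Expr).eval m = OfNat.ofNat n := rfl
@[simp] theorem eval_const (m : Mem) (c : ℤ) : (Expr.const c).eval m = c := rfl
@[simp] theorem eval_load (m : Mem) (e : Expr) : e.load.eval m = m (e.eval m) := rfl
@[simp] theorem eval_add (m : Mem) (e f : Expr) : (e + f).eval m = e.eval m + f.eval m := rfl
@[simp] theorem eval_sub (m : Mem) (e f : Expr) : (e - f).eval m = e.eval m - f.eval m := rfl
@[simp] theorem eval_mul (m : Mem) (e f : Expr) : (e * f).eval m = e.eval m * f.eval m := rfl
@[simp] theorem eval_div (m : Mem) (e f : Expr) : (e / f).eval m = e.eval m / f.eval m := rfl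

/-- The number of constants in an expression. On a memory with entries of absolute value at most
`R`, it bounds the degree in `R` of the value. -/
def leaves : Expr → ℕ
  | .const _ => 1
  | .load e => e.leaves
  | .add e f => e.leaves + f.leaves
  | .sub e f => e.leaves + f.leaves
  | .mul e f => e.leaves + f.leaves
  | .div e f => e.leaves + f.leaves

/-- The largest absolute value of a constant in an expression. -/
def maxConst : Expr → ℕ
  | .const c => c.natAbs
  | .load e => e.maxConst
  | .add e f => max e.maxConst f.maxConst
  | .sub e f => max e.maxConst f.maxConst
  | .mul e f => max e.maxConst f.maxConst
  | .div e f => max e.maxConst f.maxConst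

/-- The expression has few leaves and small constants, so that its evaluation on a bounded memory
never leaves the range of the words. -/
def Simple (e : Expr) : Prop := e.leaves ≤ 200 ∧ e.maxConst ≤ 16

instance (e : Expr) : Decidable e.Simple := inferInstanceAs (Decidable (_ ∧ _))

theorem leaves_pos (e : Expr) : 1 ≤ e.leaves := by
  induction e <;> simp only [leaves] <;> omega

theorem abs_eval_le {R : ℤ} (hR : 16 ≤ R) {m : Mem} (hm : ∀ a, |m a| ≤ R) (e : Expr)
    (he : e.maxConst ≤ 16) : |e.eval m| ≤ R ^ e.leaves := by
  have two_le : ∀ e : Expr, 2 ≤ R ^ e.leaves := fun e =>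
    le_trans (by omega : 2 ≤ R) (le_self_pow₀ (by omega) (by have := e.leaves_pos; omega))
  induction e with
  | const c =>
    simp only [maxConst] at he
    simp only [eval, leaves, pow_one, abs_le]
    omega
  | load e =>
    have := e.leaves_pos
    exact (hm _).trans (le_self_pow₀ (by omega) (by simp only [leaves]; omega))
  | add e f he' hf' =>
    simp only [maxConst, max_le_iff] at he
    have := abs_add_le (e.eval m) (f.eval m)
    have := he' he.1
    have := hf' he.2
    simp only [eval, leaves, pow_add]
    nlinarith [two_le e, two_le f]
  | sub e f he' hf' =>
    simp only [maxConst, max_le_iff] at he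
    have := abs_sub (e.eval m) (f.eval m)
    have := he' he.1
    have := hf' he.2
    simp only [eval, leaves, pow_add]
    nlinarith [two_le e, two_le f]
  | mul e f he' hf' =>
    simp only [maxConst, max_le_iff] at he
    simp only [eval, leaves, pow_add, abs_mul]
    exact mul_le_mul (he' he.1) (hf' he.2) (abs_nonneg _) (by have := two_le e; omega)
  | div e f he' hf' =>
    simp only [maxConst, max_le_iff] at he
    have := he' he.1
    simp only [eval, leaves, pow_add]
    have h1 : |e.eval m / f.eval m| ≤ |e.eval m| := by
      simpa only [Int.abs_eq_natAbs, Int.ofNat_le] using Int.natAbs_ediv_le_natAbs _ _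
    nlinarith [two_le e, two_le f]

theorem fits_of_leaves {R : ℤ} (hR : 16 ≤ R) {m : Mem} (hm : ∀ a, |m a| ≤ R) {w d : ℕ}
    (hw : R ^ d < 2 ^ w) (e : Expr) (he : e.maxConst ≤ 16) (hd : e.leaves ≤ d) : e.Fits w m := by
  have key : ∀ e : Expr, e.maxConst ≤ 16 → e.leaves ≤ d → FitsWord w (e.eval m) :=
    fun e he hd => lt_of_le_of_lt ((abs_eval_le hR hm e he).trans
      (pow_le_pow_right₀ (by omega) hd)) hw
  induction e with
  | const c => exact key (.const c) he hd
  | load e ih => exact ⟨ih he hd, key (.load e) he hd⟩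
  | add e f he' hf' =>
    have hval := key (.add e f) he hd
    simp only [maxConst, leaves, max_le_iff] at he hd
    exact ⟨he' he.1 (by omega), hf' he.2 (by omega), hval⟩
  | sub e f he' hf' =>
    have hval := key (.sub e f) he hd
    simp only [maxConst, leaves, max_le_iff] at he hd
    exact ⟨he' he.1 (by omega), hf' he.2 (by omega), hval⟩
  | mul e f he' hf' =>
    have hval := key (.mul e f) he hd
    simp only [maxConst, leaves, max_le_iff] at he hd
    exact ⟨he' he.1 (by omega), hf' he.2 (by omega), hval⟩
  | div e f he' hf' =>
    have hval := key (.div e f) he hd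
    simp only [maxConst, leaves, max_le_iff] at he hd
    exact ⟨he' he.1 (by omega), hf' he.2 (by omega), hval⟩

end Expr

/-- The bound on all words in memory during a run on an input with `b`-bit numbers. -/
def memBound (b : ℕ) : ℤ := 2 ^ (16 * (b + 1))

/-- All words of the memory are at most `memBound b` in absolute value. -/
def Bounded (b : ℕ) (m : Mem) : Prop := ∀ a, |m a| ≤ memBound b

theorem sixteen_le_memBound (b : ℕ) : 16 ≤ memBound b := by
  have : (2 : ℤ) ^ 4 ≤ 2 ^ (16 * (b + 1)) := pow_le_pow_right₀ (by norm_num) (by omega)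
  simpa [memBound] using this

theorem Bounded.update {b : ℕ} {m : Mem} (hm : Bounded b m) {v : ℤ} (a : ℤ)
    (hv : |v| ≤ memBound b) : Bounded b (Function.update m a v) := by
  intro x
  rw [Function.update_apply]
  split_ifs
  exacts [hv, hm x]

/-- The number of bits per word is `wordFactor * (b + 1)`; `3201 = 16 * 200 + 1` comes from the
exponent of `memBound` and from the number of leaves of a simple expression. -/
def wordFactor : ℕ := 3201

theorem Expr.Simple.fits {e : Expr} (he : e.Simple) {b : ℕ} {m : Mem} (hm : Bounded b m) :
    e.Fits (wordFactor * (b + 1)) m := by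
  refine Expr.fits_of_leaves (sixteen_le_memBound b) hm (d := 200) ?_ e he.2 he.1
  rw [memBound, ← pow_mul, wordFactor]
  exact pow_lt_pow_right₀ (by norm_num) (by omega)

/-- Started on `m`, the program `c` halts after at most `T` steps in a memory satisfying `Q`. -/
def Runs (b : ℕ) (c : Program) (m : Mem) (T : ℕ) (Q : Mem → Prop) : Prop :=
  ∃ t m', Exec (wordFactor * (b + 1)) c m t m' ∧ t ≤ T ∧ Q m'

/-- A bound on the running time of a program without loops. -/
def Program.cost : Program → ℕ
  | .skip => 1
  | .store a e => a.cost + e.cost + 1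
  | .seq c d => c.cost + d.cost
  | .ite e c d => e.cost + 1 + max c.cost d.cost
  | .loop _ _ => 0

section Rules

variable {b : ℕ} {m : Mem} {Q Q' : Mem → Prop}

theorem Runs.skip (hQ : Q m) : Runs b .skip m Program.skip.cost Q :=
  ⟨1, m, .skip m, le_rfl, hQ⟩

theorem Runs.store {a e : Expr} (hm : Bounded b m) (ha : a.Simple) (he : e.Simple)
    (hQ : Q (Function.update m (a.eval m) (e.eval m))) :
    Runs b (.store a e) m (Program.store a e).cost Q :=
  ⟨_, _, .store a e m (ha.fits hm) (he.fits hm), le_rfl, hQ⟩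

theorem Runs.seq {c d : Program} {T₁ T₂ : ℕ} (hc : Runs b c m T₁ Q)
    (hd : ∀ m', Q m' → Runs b d m' T₂ Q') : Runs b (.seq c d) m (T₁ + T₂) Q' := by
  obtain ⟨t₁, m₁, h1, h2, h3⟩ := hc
  obtain ⟨t₂, m₂, h4, h5, h6⟩ := hd m₁ h3
  exact ⟨_, _, .seq c d m m₁ m₂ t₁ t₂ h1 h4, Nat.add_le_add h2 h5, h6⟩

theorem Runs.ite {e : Expr} {c d : Program} {T₁ T₂ : ℕ} (hm : Bounded b m) (he : e.Simple)
    (hc : 0 < e.eval m → Runs b c m T₁ Q) (hd : e.eval m ≤ 0 → Runs b d m T₂ Q) :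
    Runs b (.ite e c d) m (e.cost + 1 + max T₁ T₂) Q := by
  rcases lt_or_ge 0 (e.eval m) with h | h
  · obtain ⟨t, m', h1, h2, h3⟩ := hc h
    exact ⟨_, _, .ite_pos e c d m m' t (he.fits hm) h h1,
      Nat.add_le_add_left (h2.trans (le_max_left _ _)) _, h3⟩
  · obtain ⟨t, m', h1, h2, h3⟩ := hd h
    exact ⟨_, _, .ite_neg e c d m m' t (he.fits hm) h h1,
      Nat.add_le_add_left (h2.trans (le_max_right _ _)) _, h3⟩

/-- A counting loop with an invariant `I`. -/
theorem Runs.loop {e : Expr} {c : Program} {N T : ℕ} {I : ℕ → Mem → Prop} (he : e.Simple)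
    (hb : ∀ i m, I i m → Bounded b m)
    (hstep : ∀ i < N, ∀ m, I i m → 0 < e.eval m ∧ Runs b c m T (I (i + 1)))
    (hend : ∀ m, I N m → e.eval m ≤ 0) (h0 : I 0 m) :
    Runs b (.loop e c) m ((N + 1) * (e.cost + 1 + T)) (I N) := by
  suffices h : ∀ d i m, i + d = N → I i m →
      Runs b (.loop e c) m ((d + 1) * (e.cost + 1 + T)) (I N) from h N 0 m (by omega) h0
  intro d
  induction d with
  | zero =>
    rintro i m rfl hi
    exact ⟨_, m, .loop_done e c m (he.fits (hb _ _ hi)) (hend m hi), by omega, hi⟩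
  | succ d ih =>
    intro i m hid hi
    obtain ⟨hpos, t₁, m₁, h1, h2, h3⟩ := hstep i (by omega) m hi
    obtain ⟨t₂, m₂, h4, h5, h6⟩ := ih (i + 1) m₁ (by omega) h3
    refine ⟨_, _, .loop_step e c m m₁ m₂ t₁ t₂ (he.fits (hb _ _ hi)) hpos h1 h4, ?_, h6⟩
    rw [Nat.succ_mul]
    omega

end Rules

/-! ### Slopes as addresses -/

/-- The slope `U / V`, rounded to a multiple of `1 / B ^ 2` and scaled to an integer; a value out of
the range of the others if `V = 0`. Multiplying numerator and denominator by `V` makes the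
denominator nonnegative, so that the quotient only depends on the fraction. -/
def slopeKey (B U V : ℤ) : ℤ := U * V * (B * B) / (V * V) + B * B * B * (1 / (V * V + 1))

theorem slopeKey_zero (B U : ℤ) : slopeKey B U 0 = B * B * B := by
  simp [slopeKey]

theorem slopeKey_of_ne_zero (B U : ℤ) {V : ℤ} (hV : V ≠ 0) :
    slopeKey B U V = U * V * (B * B) / (V * V) := by
  have : 0 < V * V := mul_self_pos.mpr hV
  have h1 : 1 / (V * V + 1) = 0 := Int.ediv_eq_zero_of_lt (by norm_num) (by omega)
  rw [slopeKey, h1, mul_zero, add_zero]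

theorem slopeKey_bounds {B U V : ℤ} (hU : |U| < B) (hV : V ≠ 0) :
    -(B * B * B) ≤ slopeKey B U V ∧ slopeKey B U V < B * B * B := by
  have hVV : 0 < V * V := mul_self_pos.mpr hV
  have hB : 0 < B := lt_of_le_of_lt (abs_nonneg U) hU
  have h1 : |U * V| ≤ (B - 1) * (V * V) := by
    rw [abs_mul]
    have h2 : |V| ≤ V * V := by
      rw [← abs_mul_abs_self V]
      have : 1 ≤ |V| := Int.one_le_abs hV
      nlinarith
    exact mul_le_mul (by omega) h2 (abs_nonneg _) (by omega)
  rw [slopeKey_of_ne_zero B U hV]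
  have h3 := abs_le.mp h1
  constructor
  · rw [Int.le_ediv_iff_mul_le hVV]
    nlinarith [mul_pos hB hB, mul_pos (mul_pos hB hB) hVV]
  · rw [Int.ediv_lt_iff_lt_mul hVV]
    nlinarith [mul_pos hB hB, mul_pos (mul_pos hB hB) hVV]

/-- The precision `1 / B ^ 2` separates distinct fractions with denominators below `B`. -/
theorem slopeKey_eq_iff_of_ne_zero {B U V U' V' : ℤ} (hB : |V| < B) (hB' : |V'| < B) (hV : V ≠ 0)
    (hV' : V' ≠ 0) : slopeKey B U V = slopeKey B U' V' ↔ U * V' = U' * V := by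
  have hVV : 0 < V * V := mul_self_pos.mpr hV
  have hVV' : 0 < V' * V' := mul_self_pos.mpr hV'
  rw [slopeKey_of_ne_zero B U hV, slopeKey_of_ne_zero B U' hV']
  constructor
  · intro h
    set q := U * V * (B * B) / (V * V)
    have h1 : q * (V * V) ≤ U * V * (B * B) := Int.ediv_mul_le _ hVV.ne'
    have h2 : U * V * (B * B) < (q + 1) * (V * V) := Int.lt_ediv_add_one_mul_self _ hVV
    have h3 : q * (V' * V') ≤ U' * V' * (B * B) := by rw [h]; exact Int.ediv_mul_le _ hVV'.ne'
    have h4 : U' * V' * (B * B) < (q + 1) * (V' * V') := by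
      rw [h]; exact Int.lt_ediv_add_one_mul_self _ hVV'
    by_contra hne
    have hd : 1 ≤ |U * V' - U' * V| := Int.one_le_abs (sub_ne_zero.mpr hne)
    -- Both fractions lie in the same interval of length `1 / B ^ 2`.
    have h5 : |(U * V' - U' * V) * (V * V') * (B * B)| < (V * V) * (V' * V') := by
      rw [abs_lt]
      constructor
      · nlinarith [mul_le_mul_of_nonneg_right h1 hVV'.le, mul_lt_mul_of_pos_right h4 hVV]
      · nlinarith [mul_le_mul_of_nonneg_right h3 hVV.le, mul_lt_mul_of_pos_right h2 hVV']
    rw [abs_mul, abs_mul, abs_mul V V', abs_of_nonneg (mul_self_nonneg B),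
      ← abs_mul_abs_self V, ← abs_mul_abs_self V'] at h5
    have a1 : 0 < |V| := abs_pos.mpr hV
    have a2 : 0 < |V'| := abs_pos.mpr hV'
    have h6 : |V| * |V'| < B * B := mul_lt_mul'' hB hB' a1.le a2.le
    have h7 : |V| * |V'| * (B * B) < |V| * |V'| * (|V| * |V'|) := by
      have : |V| * |V'| * (B * B) ≤ |U * V' - U' * V| * (|V| * |V'|) * (B * B) := by
        have : 0 ≤ |V| * |V'| * (B * B) :=
          mul_nonneg (mul_pos a1 a2).le (mul_self_nonneg B)
        nlinarith
      nlinarith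
    have := lt_of_mul_lt_mul_left h7 (mul_pos a1 a2).le
    omega
  · intro h
    rw [← Int.mul_ediv_mul_of_pos_left (U * V * (B * B)) (V * V) hVV',
      ← Int.mul_ediv_mul_of_pos_left (U' * V' * (B * B)) (V' * V') hVV]
    congr 1
    · linear_combination (V * V' * (B * B)) * h
    · ring

theorem slopeKey_eq_iff {B U V U' V' : ℤ} (hU : |U| < B) (hU' : |U'| < B) (hV : |V| < B)
    (hV' : |V'| < B) : slopeKey B U V = slopeKey B U' V' ↔
      (V = 0 ∧ V' = 0) ∨ (V ≠ 0 ∧ V' ≠ 0 ∧ U * V' = U' * V) := by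
  by_cases h : V = 0 <;> by_cases h' : V' = 0
  · simp [h, h', slopeKey_zero]
  · have := (slopeKey_bounds hU' h').2
    simp only [h, h', slopeKey_zero]
    simp
    omega
  · have := (slopeKey_bounds hU h).2
    simp only [h, h', slopeKey_zero]
    simp
    omega
  · rw [slopeKey_eq_iff_of_ne_zero hV hV' h h']
    simp [h, h']

theorem neg_le_slopeKey {B U : ℤ} (hU : |U| < B) (V : ℤ) : -(B * B * B) ≤ slopeKey B U V := by
  by_cases h : V = 0
  · have hB : 0 < B := lt_of_le_of_lt (abs_nonneg U) hU
    rw [h, slopeKey_zero]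
    have : 0 < B * B * B := by positivity
    omega
  · exact (slopeKey_bounds hU h).1

/-! ### The program: registers and arrays -/

/-- The number of points. -/
def nE : Expr := .load 0
/-- The number `k` of the instance. -/
def kE : Expr := .load 1
/-- The dual parameter. -/
def hE : Expr := nE - kE
/-- The register with the index of the point of the outer loop. -/
def iE : Expr := .load (.const (-1))
/-- The register with the index of the point of the inner loop. -/
def jE : Expr := .load (.const (-2))
/-- The register with a strict bound on numerators and denominators of slopes. -/
def bE : Expr := .load (.const (-3))
/-- The register that counts the points of the kernel. -/
def cE : Expr := .load (.const (-4))
/-- The register that counts the free points. -/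
def fE : Expr := .load (.const (-5))

/-- The `q`-th cell of the point with index `x`. The cells of the first point are `2, 3, 4, 5`. -/
def coord (q : ℤ) (x : Expr) : Expr := .load (4 * x + .const q)

/-- The address of entry `x` of the array with number `r`. The arrays `0`, `1`, `2` are interleaved
and extend to the left from address `-10`. -/
def arr (r : ℤ) (x : Expr) : Expr := .const (-10 - r) - 3 * x

/-- Numerator of the slope of the line through the points with indices `i` and `j`. -/
def slopeNum (m : Mem) (i j : ℤ) : ℤ :=
  (m (4 * j + 4) * m (4 * i + 5) - m (4 * i + 4) * m (4 * j + 5)) * (m (4 * i + 3) * m (4 * j + 3))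

/-- Denominator of the slope of the line through the points with indices `i` and `j`. -/
def slopeDen (m : Mem) (i j : ℤ) : ℤ :=
  (m (4 * j + 2) * m (4 * i + 3) - m (4 * i + 2) * m (4 * j + 3)) * (m (4 * i + 5) * m (4 * j + 5))

/-- The table cell for the direction from the point with index `i` to the one with index `j`. -/
def slot (m : Mem) (B : ℤ) (i j : ℤ) : ℤ :=
  4 * m 0 + 2 + B * B * B + slopeKey B (slopeNum m i j) (slopeDen m i j)

def slopeNumE : Expr :=
  (coord 4 jE * coord 5 iE - coord 4 iE * coord 5 jE) * (coord 3 iE * coord 3 jE)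

def slopeDenE : Expr :=
  (coord 2 jE * coord 3 iE - coord 2 iE * coord 3 jE) * (coord 5 iE * coord 5 jE)

/-- The address of the table cell for the points in the registers `iE` and `jE`. -/
def slotE : Expr :=
  4 * nE + 2 + bE * bE * bE + (slopeNumE * slopeDenE * (bE * bE) / (slopeDenE * slopeDenE) +
    bE * bE * bE * (1 / (slopeDenE * slopeDenE + 1)))

section Eval
variable (m : Mem)
@[simp] theorem eval_nE : nE.eval m = m 0 := rfl
@[simp] theorem eval_kE : kE.eval m = m 1 := rfl
@[simp] theorem eval_hE : hE.eval m = m 0 - m 1 := rfl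
@[simp] theorem eval_iE : iE.eval m = m (-1) := rfl
@[simp] theorem eval_jE : jE.eval m = m (-2) := rfl
@[simp] theorem eval_bE : bE.eval m = m (-3) := rfl
@[simp] theorem eval_cE : cE.eval m = m (-4) := rfl
@[simp] theorem eval_fE : fE.eval m = m (-5) := rfl
@[simp] theorem eval_coord (q : ℤ) (x : Expr) : (coord q x).eval m = m (4 * x.eval m + q) := rfl
@[simp] theorem eval_arr (r : ℤ) (x : Expr) : (arr r x).eval m = -10 - r - 3 * x.eval m := rfl
@[simp] theorem eval_slotE : slotE.eval m = slot m (m (-3)) (m (-1)) (m (-2)) := rfl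
end Eval

/-! ### A bound on the numerators and denominators -/

/-- Adds the square of the cell in turn to the register `bE`. -/
def sumBody : Program :=
  .seq (.store (.const (-3)) (bE + .load (iE + 2) * .load (iE + 2))) (.store (.const (-1)) (iE + 1))

/-- Stores `2 (s + n + 1) ^ 4 + 1` in the register `bE`, where `s` is the sum of the squares of all
numerators and denominators. -/
def computeBound : Program :=
  .seq (.loop (4 * nE - iE) sumBody)
    (.store (.const (-3)) (2 * ((bE + nE + 1) * (bE + nE + 1) * (bE + nE + 1) * (bE + nE + 1)) + 1))

/-- The sum of the squares of the first `J` cells of the encoding of the points. -/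
def sumSq (m : Mem) (J : ℕ) : ℤ := ∑ a ∈ Finset.range J, m ((a : ℤ) + 2) * m ((a : ℤ) + 2)

/-- The value that `computeBound` computes. -/
def slopeBound (m : Mem) (n : ℕ) : ℤ :=
  2 * ((sumSq m (4 * n) + n + 1) * (sumSq m (4 * n) + n + 1) * (sumSq m (4 * n) + n + 1) *
    (sumSq m (4 * n) + n + 1)) + 1

theorem sumSq_nonneg (m : Mem) (J : ℕ) : 0 ≤ sumSq m J :=
  Finset.sum_nonneg fun _ _ => mul_self_nonneg _

theorem abs_le_sumSq (m : Mem) {J a : ℕ} (ha : a < J) : |m ((a : ℤ) + 2)| ≤ sumSq m J := by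
  have h1 : m ((a : ℤ) + 2) * m ((a : ℤ) + 2) ≤ sumSq m J :=
    Finset.single_le_sum (f := fun a : ℕ => m ((a : ℤ) + 2) * m ((a : ℤ) + 2))
      (fun _ _ => mul_self_nonneg _) (Finset.mem_range.mpr ha)
  rw [← abs_mul_abs_self] at h1
  nlinarith [Int.lt_iff_add_one_le.mp (lt_add_one |m ((a : ℤ) + 2)|), abs_nonneg (m ((a : ℤ) + 2)),
    Int.le_self_sq |m ((a : ℤ) + 2)|]

theorem sumSq_le {b : ℕ} {m : Mem} (hm : ∀ a, FitsWord b (m a)) (J : ℕ) :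
    sumSq m J ≤ J * (2 ^ b * 2 ^ b) := by
  have h : ∀ a ∈ Finset.range J, m ((a : ℤ) + 2) * m ((a : ℤ) + 2) ≤ 2 ^ b * 2 ^ b := by
    intro a _
    rw [← abs_mul_abs_self]
    exact mul_le_mul (hm _).le (hm _).le (abs_nonneg _) (by positivity)
  have := Finset.sum_le_card_nsmul _ _ _ h
  simpa [sumSq] using this

theorem sum_add_le {b n J : ℕ} {m : Mem} (hm : ∀ a, FitsWord b (m a)) (hn : m 0 = n)
    (hJ : J ≤ 4 * n) : sumSq m J + n + 1 ≤ 8 * 2 ^ b * 2 ^ b * 2 ^ b := by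
  have h1 := sumSq_le hm J
  have h2 : (n : ℤ) + 1 ≤ 2 ^ b := by
    have := hm 0
    rw [hn, FitsWord, Nat.abs_cast] at this
    omega
  have h3 : (J : ℤ) ≤ 4 * 2 ^ b := by
    have : (J : ℤ) ≤ 4 * n := by exact_mod_cast hJ
    omega
  have hX : (1 : ℤ) ≤ 2 ^ b := one_le_pow₀ (by norm_num)
  set X : ℤ := 2 ^ b
  have h4 : (J : ℤ) * (X * X) ≤ 4 * X * (X * X) :=
    mul_le_mul_of_nonneg_right h3 (by positivity)
  have h5 : X ≤ X * X := by nlinarith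
  have h6 : X * X ≤ X * X * X := by nlinarith
  nlinarith

theorem slopeBound_le {b n : ℕ} {m : Mem} (hm : ∀ a, FitsWord b (m a)) (hn : m 0 = n) :
    slopeBound m n ≤ memBound b := by
  have h1 := sum_add_le hm hn le_rfl
  have h0 := sumSq_nonneg m (4 * n)
  have hX : (1 : ℤ) ≤ 2 ^ b := one_le_pow₀ (by norm_num)
  have hR : memBound b = 65536 * (2 ^ b) ^ 16 := by
    rw [memBound, ← pow_mul, mul_add, pow_add, mul_comm, mul_comm b]; norm_num
  rw [slopeBound, hR]
  set X : ℤ := 2 ^ b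
  set s := sumSq m (4 * n) + n + 1
  have hs : 0 ≤ s := by omega
  have h2 : s * s * s * s ≤ (8 * X * X * X) ^ 4 := by
    have := pow_le_pow_left₀ hs h1 4
    linarith [this, (by ring : s ^ 4 = s * s * s * s)]
  have h3 : X ^ 12 ≤ X ^ 16 := pow_le_pow_right₀ hX (by norm_num)
  have h4 : (1 : ℤ) ≤ X ^ 12 := one_le_pow₀ hX
  have h5 : (8 * X * X * X) ^ 4 = 4096 * X ^ 12 := by ring
  omega

theorem le_slopeBound (m : Mem) (n : ℕ) : sumSq m (4 * n) + n + 1 ≤ slopeBound m n := by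
  have h0 := sumSq_nonneg m (4 * n)
  rw [slopeBound]
  set s := sumSq m (4 * n) + n + 1
  have hs : 1 ≤ s := by omega
  have h1 : s ≤ s * s := by nlinarith
  have h2 : s * s ≤ s * s * s := by nlinarith
  have h3 : s * s * s ≤ s * s * s * s := by nlinarith
  omega

theorem abs_cross_lt {s a b c d e f : ℤ} (ha : |a| ≤ s) (hb : |b| ≤ s) (hc : |c| ≤ s)
    (hd : |d| ≤ s) (he : |e| ≤ s) (hf : |f| ≤ s) :
    |(a * b - c * d) * (e * f)| < 2 * (s * s * s * s) + 1 := by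
  have hs : 0 ≤ s := (abs_nonneg a).trans ha
  have mul_le : ∀ {x y : ℤ}, |x| ≤ s → |y| ≤ s → |x * y| ≤ s * s := fun hx hy => by
    rw [abs_mul]; exact mul_le_mul hx hy (abs_nonneg _) hs
  have h1 : |a * b - c * d| ≤ 2 * (s * s) := by
    have := abs_sub (a * b) (c * d)
    linarith [mul_le ha hb, mul_le hc hd]
  have h2 : |(a * b - c * d) * (e * f)| ≤ 2 * (s * s) * (s * s) := by
    rw [abs_mul]; exact mul_le_mul h1 (mul_le he hf) (abs_nonneg _) (by positivity)
  nlinarith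

theorem abs_slope_lt (m : Mem) {n i j : ℕ} (hi : i < n) (hj : j < n) :
    |slopeNum m i j| < slopeBound m n ∧ |slopeDen m i j| < slopeBound m n := by
  have key : ∀ x : ℕ, x < n → ∀ q : ℕ, q < 4 →
      |m (4 * (x : ℤ) + (q + 2 : ℕ))| ≤ sumSq m (4 * n) + n + 1 := by
    intro x hx q hq
    have := abs_le_sumSq m (J := 4 * n) (a := 4 * x + q) (by omega)
    have h2 : ((4 * x + q : ℕ) : ℤ) + 2 = 4 * (x : ℤ) + (q + 2 : ℕ) := by push_cast; ring
    rw [h2] at this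
    omega
  exact ⟨abs_cross_lt (key j hj 2 (by norm_num)) (key i hi 3 (by norm_num))
      (key i hi 2 (by norm_num)) (key j hj 3 (by norm_num)) (key i hi 1 (by norm_num))
      (key j hj 1 (by norm_num)),
    abs_cross_lt (key j hj 0 (by norm_num)) (key i hi 1 (by norm_num))
      (key i hi 0 (by norm_num)) (key j hj 1 (by norm_num)) (key i hi 3 (by norm_num))
      (key j hj 3 (by norm_num))⟩

/-- Invariant of the summation, where `m₀` is the initial memory. -/
structure SumInv (b : ℕ) (m₀ : Mem) (n J : ℕ) (m : Mem) : Prop where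
  bounded : Bounded b m
  i_eq : m (-1) = J
  sum_eq : m (-3) = sumSq m₀ J
  frame : ∀ a, a ≠ -1 → a ≠ -3 → m a = m₀ a

theorem runs_computeBound {b n : ℕ} {m₀ : Mem} (hm : ∀ a, FitsWord b (m₀ a)) (hn : m₀ 0 = n)
    (h1 : m₀ (-1) = 0) (h3 : m₀ (-3) = 0) :
    Runs b computeBound m₀
      ((4 * n + 1) * ((4 * nE - iE).cost + 1 + sumBody.cost) +
        (Program.store (.const (-3))
          (2 * ((bE + nE + 1) * (bE + nE + 1) * (bE + nE + 1) * (bE + nE + 1)) + 1)).cost)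
      (fun m => Bounded b m ∧ m (-3) = slopeBound m₀ n ∧ ∀ a, a ≠ -1 → a ≠ -3 → m a = m₀ a) := by
  have hle : ∀ J ≤ 4 * n, sumSq m₀ J ≤ memBound b ∧ (n : ℤ) * 4 ≤ memBound b := by
    intro J hJ
    have h4 := sum_add_le hm hn hJ
    have h0 := sumSq_nonneg m₀ J
    have hX : (1 : ℤ) ≤ 2 ^ b := one_le_pow₀ (by norm_num)
    have hR : memBound b = 65536 * (2 ^ b) ^ 16 := by
      rw [memBound, ← pow_mul, mul_add, pow_add, mul_comm, mul_comm b]; norm_num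
    have h5 : ((2 : ℤ) ^ b) ^ 3 ≤ (2 ^ b) ^ 16 := pow_le_pow_right₀ hX (by norm_num)
    have h6 : 8 * (2 : ℤ) ^ b * 2 ^ b * 2 ^ b = 8 * (2 ^ b) ^ 3 := by ring
    omega
  have hb0 : Bounded b m₀ := by
    intro a
    refine (hm a).le.trans ?_
    exact pow_le_pow_right₀ (by norm_num) (by omega)
  refine Runs.seq (Q := SumInv b m₀ n (4 * n)) (Runs.loop (I := SumInv b m₀ n) (by decide)
    (fun _ _ h => h.bounded) ?_ ?_ ⟨hb0, by simpa using h1, by simpa [sumSq] using h3,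
      fun _ _ _ => rfl⟩) ?_
  · intro J hJ m h
    have h0 : m 0 = n := by rw [h.frame 0 (by norm_num) (by norm_num), hn]
    refine ⟨by simp [h0, h.i_eq]; omega, ?_⟩
    have hs : m (-3) + m (m (-1) + 2) * m (m (-1) + 2) = sumSq m₀ (J + 1) := by
      rw [h.sum_eq, h.i_eq, h.frame _ (by omega) (by omega), sumSq, sumSq, Finset.sum_range_succ]
    have hs0 := sumSq_nonneg m₀ (J + 1)
    have hbd : Bounded b (Function.update m (-3) (sumSq m₀ (J + 1))) :=
      h.bounded.update _ (by rw [abs_of_nonneg hs0]; exact (hle _ (by omega)).1)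
    refine Runs.seq (Q := fun m' => m' = Function.update m (-3) (sumSq m₀ (J + 1)))
      (Runs.store h.bounded (by decide) (by decide) (by simp [hs])) ?_
    rintro _ rfl
    refine Runs.store hbd (by decide) (by decide) ?_
    have hv : (iE + 1).eval (Function.update m (-3) (sumSq m₀ (J + 1))) = ((J + 1 : ℕ) : ℤ) := by
      simp [h.i_eq]
    rw [hv, Expr.eval_const]
    have := (hle 0 (by omega)).2
    refine ⟨hbd.update _ (by rw [abs_of_nonneg (by omega)]; omega), by simp, by simp, ?_⟩
    intro a h1 h3
    rw [Function.update_of_ne h1, Function.update_of_ne h3, h.frame a h1 h3]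
  · intro m h
    have h0 : m 0 = n := by rw [h.frame 0 (by norm_num) (by norm_num), hn]
    simp [h0, h.i_eq]
  · intro m h
    have h0 : m 0 = n := by rw [h.frame 0 (by norm_num) (by norm_num), hn]
    refine Runs.store h.bounded (by decide) (by decide) ?_
    have hv : (2 * ((bE + nE + 1) * (bE + nE + 1) * (bE + nE + 1) * (bE + nE + 1)) + 1 :
        Expr).eval m = slopeBound m₀ n := by
      simp [h0, h.sum_eq, slopeBound]
    rw [hv, Expr.eval_const]
    refine ⟨h.bounded.update _ ?_, by simp, fun a h1 h3 => ?_⟩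
    · have := le_slopeBound m₀ n
      have := sumSq_nonneg m₀ (4 * n)
      rw [abs_of_nonneg (by omega)]
      exact slopeBound_le hm hn
    · rw [Function.update_of_ne h3, h.frame a h1 h3]

/-! ### Counting the repeated directions -/

/-- The stamp of row `i` of scan number `t`. The stamps increase from row to row, so that the
table never has to be cleared. -/
def stampE (t : ℤ) : Expr := .const t * nE + iE + 1

/-- If the direction from point `i` to point `j` has already occurred in row `i`, this increases
entry `i` of the array `t + 1`; otherwise it records the direction. Points whose entry in the array
`t` exceeds the dual parameter are ignored. -/
def scanStep (t : ℤ) : Program :=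
  .ite (hE + 1 - .load (arr t jE))
    (.ite ((iE - jE) * (iE - jE))
      (.ite (stampE t - .load slotE)
        (.store slotE (stampE t))
        (.store (arr (t + 1) iE) (.load (arr (t + 1) iE) + 1)))
      .skip)
    .skip

/-- One step of the inner loop. -/
def scanBody (t : ℤ) : Program := .seq (scanStep t) (.store (.const (-2)) (jE + 1))

/-- Row `i`: compares point `i` with all the others. -/
def scanRow (t : ℤ) : Program :=
  .seq (.store (.const (-2)) 0)
    (.seq (.loop (nE - jE) (scanBody t)) (.store (.const (-1)) (iE + 1)))

/-- Scan number `t`, with `t = 0` or `t = 1`: counts the repeated directions at every point, among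
the points whose entry in the array `t` is at most the dual parameter. The array `0` is zero, so
that the first scan takes all points into account. -/
def scan (t : ℤ) : Program := .seq (.store (.const (-1)) 0) (.loop (nE - iE) (scanRow t))

/-- The entry of point `j` in the array `t` does not exceed the dual parameter. -/
abbrev Alive (t : ℤ) (m : Mem) (j : ℕ) : Prop := m (-10 - t - 3 * j) ≤ m 0 - m 1

/-- The points that have been compared with point `i` when `J` points have been visited. -/
def row (t : ℤ) (m : Mem) (i J : ℕ) : Finset ℕ :=
  (Finset.range J).filter fun j => Alive t m j ∧ j ≠ i

/-- The table cells that have been stamped in row `i` when `J` points have been visited. -/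
def slots (B t : ℤ) (m : Mem) (i J : ℕ) : Finset ℤ :=
  (row t m i J).image fun j : ℕ => slot m B i j

/-- The number of repetitions found in row `i` when `J` points have been visited. -/
def repeats (B t : ℤ) (m : Mem) (i J : ℕ) : ℕ := (row t m i J).card - (slots B t m i J).card

section Repeats

variable {B t : ℤ} {m : Mem} {i J : ℕ}

theorem repeats_le : repeats B t m i J ≤ J := by
  have : (row t m i J).card ≤ J := (Finset.card_filter_le _ _).trans (Finset.card_range J).le
  unfold repeats
  omega

theorem row_succ_of_not (h : ¬ (Alive t m J ∧ J ≠ i)) : row t m i (J + 1) = row t m i J := by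
  rw [row, Finset.range_add_one, Finset.filter_insert, if_neg h, row]

theorem row_succ (h : Alive t m J ∧ J ≠ i) : row t m i (J + 1) = insert J (row t m i J) := by
  rw [row, Finset.range_add_one, Finset.filter_insert, if_pos h, row]

theorem slots_succ (h : Alive t m J ∧ J ≠ i) :
    slots B t m i (J + 1) = insert (slot m B i J) (slots B t m i J) := by
  rw [slots, row_succ h, Finset.image_insert, slots]

theorem card_row_succ (h : Alive t m J ∧ J ≠ i) :
    (row t m i (J + 1)).card = (row t m i J).card + 1 := by
  rw [row_succ h, Finset.card_insert_of_notMem]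
  simp [row]

theorem repeats_succ_of_mem (h : Alive t m J ∧ J ≠ i) (hs : slot m B i J ∈ slots B t m i J) :
    repeats B t m i (J + 1) = repeats B t m i J + 1 := by
  have h1 : (slots B t m i J).card ≤ (row t m i J).card := Finset.card_image_le
  rw [repeats, card_row_succ h, slots_succ h, Finset.insert_eq_of_mem hs, repeats]
  omega

theorem repeats_succ_of_notMem (h : Alive t m J ∧ J ≠ i) (hs : slot m B i J ∉ slots B t m i J) :
    repeats B t m i (J + 1) = repeats B t m i J := by
  rw [repeats, card_row_succ h, slots_succ h, Finset.card_insert_of_notMem hs, repeats]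
  omega

end Repeats

/-- What a scan needs to know about the memory `m₀` at its start. -/
structure ScanInput (b n : ℕ) (B t : ℤ) (m₀ : Mem) : Prop where
  t_eq : t = 0 ∨ t = 1
  bounded : Bounded b m₀
  n_eq : m₀ 0 = n
  bnd_eq : m₀ (-3) = B
  small : 2 * (n : ℤ) ≤ memBound b
  slope_lt : ∀ i j : ℕ, i < n → j < n → |slopeNum m₀ i j| < B
  dst : ∀ x : ℕ, m₀ (-10 - (t + 1) - 3 * x) = 0
  table : ∀ a, 4 * (n : ℤ) + 2 ≤ a → m₀ a ≤ t * n

/-- Nothing changes except for the loop registers, the table, and the array `t + 1`. -/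
def ScanFrame (n : ℕ) (t : ℤ) (m₀ m : Mem) : Prop :=
  ∀ a, a ≠ -1 → a ≠ -2 → a < 4 * (n : ℤ) + 2 → (∀ x : ℕ, a ≠ -10 - (t + 1) - 3 * x) → m a = m₀ a

/-- Invariant of a scan when the first `i` rows are complete. -/
structure ScanInv (b n : ℕ) (B t : ℤ) (m₀ : Mem) (i : ℕ) (m : Mem) : Prop where
  bounded : Bounded b m
  i_eq : m (-1) = i
  frame : ScanFrame n t m₀ m
  dst : ∀ x : ℕ, m (-10 - (t + 1) - 3 * x) = if x < i then (repeats B t m₀ x n : ℤ) else 0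
  table : ∀ a, 4 * (n : ℤ) + 2 ≤ a → m a ≤ t * n + i

/-- Invariant inside row `i`, up to the value of the inner loop register. -/
structure RowState (b n : ℕ) (B t : ℤ) (m₀ : Mem) (i J : ℕ) (m : Mem) : Prop where
  bounded : Bounded b m
  i_eq : m (-1) = i
  frame : ScanFrame n t m₀ m
  dst : ∀ x : ℕ, m (-10 - (t + 1) - 3 * x) = if x < i then (repeats B t m₀ x n : ℤ) else
    if x = i then (repeats B t m₀ i J : ℤ) else 0
  table : ∀ a, 4 * (n : ℤ) + 2 ≤ a →
    m a ≤ t * n + i + 1 ∧ (m a = t * n + i + 1 ↔ a ∈ slots B t m₀ i J)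

section Scan

variable {b n : ℕ} {B t : ℤ} {m₀ m : Mem} {i J : ℕ}

theorem ScanFrame.input (h : ScanFrame n t m₀ m) (ht : t = 0 ∨ t = 1) {a : ℤ} (h0 : -10 ≤ a)
    (h1 : a ≠ -1) (h2 : a ≠ -2) (ha : a < 4 * (n : ℤ) + 2) : m a = m₀ a :=
  h a h1 h2 ha fun x => by omega

theorem ScanFrame.slot_eq (h : ScanFrame n t m₀ m) (ht : t = 0 ∨ t = 1) (hi : i < n) (hj : J < n) :
    slot m B i J = slot m₀ B i J := by
  have e : ∀ x : ℕ, x < n → ∀ q : ℤ, 2 ≤ q → q ≤ 5 → m (4 * x + q) = m₀ (4 * x + q) :=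
    fun x hx q h2 h5 => h.input ht (by omega) (by omega) (by omega) (by omega)
  have h0 : m 0 = m₀ 0 := h.input ht (by omega) (by omega) (by omega) (by omega)
  simp only [slot, slopeNum, slopeDen, h0, e i hi 2 (by omega) (by omega),
    e i hi 3 (by omega) (by omega), e i hi 4 (by omega) (by omega), e i hi 5 (by omega) (by omega),
    e J hj 2 (by omega) (by omega), e J hj 3 (by omega) (by omega), e J hj 4 (by omega) (by omega),
    e J hj 5 (by omega) (by omega)]

theorem ScanInput.le_slot (h : ScanInput b n B t m₀) (hi : i < n) (hj : J < n) :
    4 * (n : ℤ) + 2 ≤ slot m₀ B i J := by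
  have := neg_le_slopeKey (h.slope_lt i J hi hj) (slopeDen m₀ i J)
  rw [slot, h.n_eq]
  omega

theorem ScanInput.stamp_bounds (h : ScanInput b n B t m₀) (hi : i < n) :
    0 ≤ t * n + i + 1 ∧ t * n + i + 1 ≤ memBound b := by
  have := h.small
  rcases h.t_eq with rfl | rfl <;> constructor <;> omega

theorem runs_scanStep (h : ScanInput b n B t m₀) (hi : i < n) (hj : J < n)
    (hm : RowState b n B t m₀ i J m) (hJ : m (-2) = J) :
    Runs b (scanStep t) m (scanStep t).cost
      (fun m' => RowState b n B t m₀ i (J + 1) m' ∧ m' (-2) = J) := by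
  have ht := h.t_eq
  have hn : m 0 = n := by
    rw [hm.frame.input ht (by omega) (by omega) (by omega) (by omega), h.n_eq]
  have hB : m (-3) = B := by
    rw [hm.frame.input ht (by omega) (by omega) (by omega) (by omega), h.bnd_eq]
  have h0 : m 0 = m₀ 0 := by rw [hn, h.n_eq]
  have h1 : m 1 = m₀ 1 := hm.frame.input ht (by omega) (by omega) (by omega) (by omega)
  have hsrc : m (-10 - t - 3 * (J : ℤ)) = m₀ (-10 - t - 3 * (J : ℤ)) :=
    hm.frame _ (by omega) (by omega) (by omega) (fun x => by omega)
  have hslot : slotE.eval m = slot m₀ B i J := by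
    rw [eval_slotE, hB, hm.i_eq, hJ, hm.frame.slot_eq ht hi hj]
  have hstamp : (stampE t).eval m = t * n + i + 1 := by
    simp [stampE, hn, hm.i_eq]
  have hsl := h.le_slot hi hj
  -- If point `J` is not to be compared with point `i`, then the state may stay as it is.
  have hskip : ¬ (Alive t m₀ J ∧ J ≠ i) → RowState b n B t m₀ i (J + 1) m ∧ m (-2) = J := by
    intro hal
    refine ⟨⟨hm.bounded, hm.i_eq, hm.frame, ?_, ?_⟩, hJ⟩
    · simpa only [repeats, slots, row_succ_of_not hal] using hm.dst
    · simpa only [slots, row_succ_of_not hal] using hm.table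
  refine Runs.ite hm.bounded (by rcases ht with rfl | rfl <;> decide) (fun h3 => ?_)
    (fun h3 => Runs.skip (hskip ?_))
  swap
  · rintro ⟨h4, -⟩
    simp [h0, h1, hJ, hsrc] at h3
    simp only [Alive] at h4
    omega
  have h4 : Alive t m₀ J := by
    simp [h0, h1, hJ, hsrc] at h3
    simp only [Alive]
    omega
  refine Runs.ite hm.bounded (by decide) (fun h5 => ?_) (fun h5 => Runs.skip (hskip ?_))
  swap
  · rintro ⟨-, h6⟩
    simp [hJ, hm.i_eq] at h5
    have : (0 : ℤ) < ((i : ℤ) - J) * ((i : ℤ) - J) := mul_self_pos.mpr (by omega)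
    omega
  have h6 : J ≠ i := by
    rintro rfl
    simp [hJ, hm.i_eq] at h5
  have hal : Alive t m₀ J ∧ J ≠ i := ⟨h4, h6⟩
  refine Runs.ite hm.bounded (by rcases ht with rfl | rfl <;> decide) (fun h7 => ?_) (fun h7 => ?_)
  · -- A new direction.
    rw [Expr.eval_sub, Expr.eval_load, hslot, hstamp] at h7
    have hnot : slot m₀ B i J ∉ slots B t m₀ i J := by
      intro hmem
      have := (hm.table _ hsl).2.mpr hmem
      omega
    refine Runs.store hm.bounded (by decide) (by rcases ht with rfl | rfl <;> decide) ?_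
    rw [hslot, hstamp]
    have hsb := h.stamp_bounds hi
    refine ⟨⟨hm.bounded.update _ (by rw [abs_of_nonneg hsb.1]; exact hsb.2), ?_, ?_, ?_, ?_⟩, ?_⟩
    · rw [Function.update_of_ne (by omega), hm.i_eq]
    · intro a ha1 ha2 ha3 ha4
      rw [Function.update_of_ne (by omega)]
      exact hm.frame a ha1 ha2 ha3 ha4
    · intro x
      rw [Function.update_of_ne (by omega), hm.dst x, repeats_succ_of_notMem hal hnot]
    · intro a ha
      rw [slots_succ hal, Finset.mem_insert, Function.update_apply]
      split_ifs with hc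
      · simp [hc]
      · simpa [hc] using hm.table a ha
    · rw [Function.update_of_ne (by omega), hJ]
  · -- A repetition.
    rw [Expr.eval_sub, Expr.eval_load, hslot, hstamp] at h7
    have htab := hm.table _ hsl
    have hmem : slot m₀ B i J ∈ slots B t m₀ i J := htab.2.mp (by omega)
    have hd := hm.dst i
    rw [if_neg (lt_irrefl i), if_pos rfl] at hd
    refine Runs.store hm.bounded (by rcases ht with rfl | rfl <;> decide)
      (by rcases ht with rfl | rfl <;> decide) ?_
    have ha : (arr (t + 1) iE).eval m = -10 - (t + 1) - 3 * (i : ℤ) := by simp [hm.i_eq]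
    have hv : (.load (arr (t + 1) iE) + 1 : Expr).eval m =
        ((repeats B t m₀ i (J + 1) : ℕ) : ℤ) := by
      rw [Expr.eval_add, Expr.eval_load, ha, hd, repeats_succ_of_mem hal hmem]
      simp
    rw [ha, hv]
    have hle : repeats B t m₀ i (J + 1) ≤ J + 1 := repeats_le
    have hsmall := h.small
    refine ⟨⟨hm.bounded.update _ (by rw [abs_of_nonneg (by omega)]; omega), ?_, ?_, ?_, ?_⟩, ?_⟩
    · rw [Function.update_of_ne (by omega), hm.i_eq]
    · intro a ha1 ha2 ha3 ha4
      rw [Function.update_of_ne (ha4 i)]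
      exact hm.frame a ha1 ha2 ha3 ha4
    · intro x
      rw [Function.update_apply, hm.dst x]
      by_cases hx : x = i
      · simp [hx]
      · rw [if_neg (by omega), if_neg hx, if_neg hx]
    · intro a ha'
      rw [slots_succ hal, Finset.insert_eq_of_mem hmem, Function.update_of_ne (by omega)]
      exact hm.table a ha'
    · rw [Function.update_of_ne (by omega), hJ]

theorem RowState.update_j (hm : RowState b n B t m₀ i J m) (ht : t = 0 ∨ t = 1) {v : ℤ}
    (hv : |v| ≤ memBound b) : RowState b n B t m₀ i J (Function.update m (-2) v) where
  bounded := hm.bounded.update _ hv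
  i_eq := by rw [Function.update_of_ne (by omega), hm.i_eq]
  frame := fun a h1 h2 h3 h4 => by rw [Function.update_of_ne h2, hm.frame a h1 h2 h3 h4]
  dst := fun x => by rw [Function.update_of_ne (by omega), hm.dst x]
  table := fun a ha => by rw [Function.update_of_ne (by omega)]; exact hm.table a ha

theorem runs_scanBody (h : ScanInput b n B t m₀) (hi : i < n) (hj : J < n)
    (hm : RowState b n B t m₀ i J m) (hJ : m (-2) = J) :
    Runs b (scanBody t) m (scanBody t).cost
      (fun m' => RowState b n B t m₀ i (J + 1) m' ∧ m' (-2) = (J + 1 : ℕ)) := by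
  have hsmall := h.small
  refine Runs.seq (runs_scanStep h hi hj hm hJ) ?_
  rintro m' ⟨hm', hJ'⟩
  refine Runs.store hm'.bounded (by decide) (by decide) ?_
  have hv : (jE + 1).eval m' = ((J + 1 : ℕ) : ℤ) := by simp [hJ']
  rw [hv, Expr.eval_const]
  exact ⟨hm'.update_j h.t_eq (by rw [abs_of_nonneg (by omega)]; omega), by simp⟩

/-- The running time of a row. -/
def rowTime (t : ℤ) (n : ℕ) : ℕ :=
  (Program.store (.const (-2)) 0).cost +
    ((n + 1) * ((nE - jE).cost + 1 + (scanBody t).cost) +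
      (Program.store (.const (-1)) (iE + 1)).cost)

theorem runs_scanRow (h : ScanInput b n B t m₀) (hi : i < n) (hm : ScanInv b n B t m₀ i m) :
    Runs b (scanRow t) m (rowTime t n) (ScanInv b n B t m₀ (i + 1)) := by
  have ht := h.t_eq
  have hsmall := h.small
  have hstart : RowState b n B t m₀ i 0 m := by
    refine ⟨hm.bounded, hm.i_eq, hm.frame, ?_, ?_⟩
    · intro x
      rw [hm.dst x]
      simp [repeats, row]
    · intro a ha
      have := hm.table a ha
      simp only [slots, row, Finset.range_zero, Finset.filter_empty, Finset.image_empty,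
        Finset.notMem_empty, iff_false]
      omega
  refine Runs.seq (Q := fun m' => RowState b n B t m₀ i 0 m' ∧ m' (-2) = (0 : ℕ))
    (Runs.store hm.bounded (by decide) (by decide) ?_) ?_
  · rw [Expr.eval_ofNat, Expr.eval_const]
    exact ⟨hstart.update_j ht (by simp; omega), by simp⟩
  intro m₁ hm₁
  have hn : ∀ J m', RowState b n B t m₀ i J m' → m' 0 = n := fun J m' hm' => by
    rw [hm'.frame.input ht (by omega) (by omega) (by omega) (by omega), h.n_eq]
  refine Runs.seq (Runs.loop
    (I := fun J m' => RowState b n B t m₀ i J m' ∧ m' (-2) = (J : ℤ)) (N := n)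
    (by decide) (fun _ _ h => h.1.bounded) ?_ ?_ hm₁) ?_
  · rintro J hJ m' ⟨hm', hJ'⟩
    refine ⟨?_, runs_scanBody h hi hJ hm' hJ'⟩
    simp [hn J m' hm', hJ']
    omega
  · rintro m' ⟨hm', hJ'⟩
    simp [hn n m' hm', hJ']
  · rintro m' ⟨hm', -⟩
    refine Runs.store hm'.bounded (by decide) (by decide) ?_
    have hv : (iE + 1).eval m' = ((i + 1 : ℕ) : ℤ) := by simp [hm'.i_eq]
    rw [hv, Expr.eval_const]
    refine ⟨hm'.bounded.update _ (by rw [abs_of_nonneg (by omega)]; omega), by simp, ?_, ?_, ?_⟩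
    · intro a h1 h2 h3 h4
      rw [Function.update_of_ne h1, hm'.frame a h1 h2 h3 h4]
    · intro x
      rw [Function.update_of_ne (by omega), hm'.dst x]
      rcases lt_trichotomy x i with hx | rfl | hx
      · rw [if_pos hx, if_pos (by omega)]
      · simp
      · rw [if_neg (by omega), if_neg (by omega), if_neg (by omega)]
    · intro a ha
      rw [Function.update_of_ne (by omega)]
      have := (hm'.table a ha).1
      push_cast
      omega

/-- The running time of a scan. -/
def scanTime (t : ℤ) (n : ℕ) : ℕ :=
  (Program.store (.const (-1)) 0).cost + (n + 1) * ((nE - iE).cost + 1 + rowTime t n)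

/-- A scan writes the numbers of repetitions into the array `t + 1`. -/
theorem runs_scan (h : ScanInput b n B t m₀) :
    Runs b (scan t) m₀ (scanTime t n) (ScanInv b n B t m₀ n) := by
  have ht := h.t_eq
  refine Runs.seq (Q := ScanInv b n B t m₀ 0)
    (Runs.store h.bounded (by decide) (by decide) ?_) ?_
  · rw [Expr.eval_ofNat, Expr.eval_const]
    refine ⟨h.bounded.update _ (by have := sixteen_le_memBound b; simp; omega), by simp, ?_, ?_, ?_⟩
    · intro a h1 h2 h3 h4
      rw [Function.update_of_ne h1]
    · intro x
      rw [Function.update_of_ne (by omega), h.dst x]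
      simp
    · intro a ha
      rw [Function.update_of_ne (by omega)]
      simpa using h.table a ha
  intro m hm
  have hn : ∀ i m', ScanInv b n B t m₀ i m' → m' 0 = n := fun i m' hm' => by
    rw [hm'.frame.input ht (by omega) (by omega) (by omega) (by omega), h.n_eq]
  refine Runs.loop (by decide) (fun _ _ h => h.bounded) ?_ ?_ hm
  · intro i hi m' hm'
    refine ⟨?_, runs_scanRow h hi hm'⟩
    simp [hn i m' hm', hm'.i_eq]
    omega
  · intro m' hm'
    simp [hn n m' hm', hm'.i_eq]

end Scan

/-! ### Moving the kernel to the front -/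

/-- Copies the numerator or denominator in cell `q` of point `i` to its new place. -/
def copyCell (q : ℤ) : Program := .store (4 * cE + .const q) (coord q iE)

def copyPoint : Program :=
  .seq (copyCell 2) (.seq (copyCell 3) (.seq (copyCell 4) (copyCell 5)))

def compactStep : Program :=
  .ite (hE + 1 - .load (arr 1 iE))
    (.ite (.load (arr 2 iE))
      (.seq copyPoint (.store (.const (-4)) (cE + 1)))
      (.store (.const (-5)) (fE + 1)))
    .skip

def compactBody : Program := .seq compactStep (.store (.const (-1)) (iE + 1))

/-- Moves the points that are light and not free to the front, counting them in `cE`, and counts the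
free points in `fE`. -/
def compact : Program := .seq (.store (.const (-1)) 0) (.loop (nE - iE) compactBody)

/-- Point `j` belongs to the kernel. -/
abbrev Kept (m : Mem) (j : ℕ) : Prop := Alive 1 m j ∧ 0 < m (-10 - 2 - 3 * j)

/-- Point `j` is free. -/
abbrev Freed (m : Mem) (j : ℕ) : Prop := Alive 1 m j ∧ m (-10 - 2 - 3 * j) ≤ 0

/-- The indices below `i` of points of the kernel. -/
def keptList (m : Mem) (i : ℕ) : List ℕ := (List.range i).filter (fun j => Kept m j)

/-- The indices below `i` of free points. -/
def freedList (m : Mem) (i : ℕ) : List ℕ := (List.range i).filter (fun j => Freed m j)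

/-- Invariant while a point is copied from index `i` to index `C`: the cells before `q` are done. -/
structure CopyInv (b : ℕ) (C i : ℤ) (m : Mem) (q : ℤ) (m' : Mem) : Prop where
  bounded : Bounded b m'
  cells : ∀ p, 2 ≤ p → p < q → m' (4 * C + p) = m (4 * i + p)
  frame : ∀ a, a < 4 * C + 2 ∨ 4 * C + q ≤ a → m' a = m a

/-- Invariant of `compact` when the points before `i` have been visited. -/
structure CompactInv (b : ℕ) (m₀ : Mem) (i : ℕ) (m : Mem) : Prop where
  bounded : Bounded b m
  i_eq : m (-1) = i
  c_eq : m (-4) = (keptList m₀ i).length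
  f_eq : m (-5) = (freedList m₀ i).length
  frame : ∀ a, a ≠ -1 → a ≠ -4 → a ≠ -5 → a < 2 ∨ 4 * (i : ℤ) + 2 ≤ a → m a = m₀ a
  cells : ∀ (x : ℕ) (hx : x < (keptList m₀ i).length) (q : ℤ), 2 ≤ q → q ≤ 5 →
    m (4 * x + q) = m₀ (4 * ((keptList m₀ i)[x] : ℕ) + q)

section Compact

variable {b n : ℕ} {m₀ m m' : Mem} {i : ℕ}

theorem runs_copyCell {C q : ℤ} (hC0 : 0 ≤ C) (hC : C ≤ i) (hq : q = 2 ∨ q = 3 ∨ q = 4 ∨ q = 5)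
    (hc : m (-4) = C) (hi : m (-1) = i) (h : CopyInv b C i m q m') :
    Runs b (copyCell q) m' (copyCell q).cost (CopyInv b C i m (q + 1)) := by
  have hc' : m' (-4) = C := by rw [h.frame _ (by omega), hc]
  have hi' : m' (-1) = i := by rw [h.frame _ (by omega), hi]
  refine Runs.store h.bounded (by rcases hq with rfl | rfl | rfl | rfl <;> decide)
    (by rcases hq with rfl | rfl | rfl | rfl <;> decide) ?_
  have ha : (4 * cE + .const q : Expr).eval m' = 4 * C + q := by simp [hc']
  -- The source cell has not been overwritten, because `C ≤ i`.
  have hv : (coord q iE).eval m' = m (4 * i + q) := by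
    rw [eval_coord, eval_iE, hi', h.frame _ (by omega)]
  rw [ha, hv]
  refine ⟨h.bounded.update _ ?_, ?_, ?_⟩
  · rw [← h.frame _ (by omega)]
    exact h.bounded _
  · intro p h2 hp
    by_cases hpq : p = q
    · rw [hpq, Function.update_self]
    · rw [Function.update_of_ne (by omega), h.cells p h2 (by omega)]
  · intro a ha'
    rw [Function.update_of_ne (by omega), h.frame a (by omega)]

theorem runs_copyPoint {C : ℤ} (hC0 : 0 ≤ C) (hC : C ≤ i) (hm : Bounded b m)
    (hc : m (-4) = C) (hi : m (-1) = i) :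
    Runs b copyPoint m copyPoint.cost (CopyInv b C i m 6) :=
  Runs.seq (runs_copyCell hC0 hC (by simp) hc hi ⟨hm, fun p _ _ => by omega, fun _ _ => rfl⟩)
    fun _ h3 => Runs.seq (runs_copyCell hC0 hC (by simp) hc hi h3)
      fun _ h4 => Runs.seq (runs_copyCell hC0 hC (by simp) hc hi h4)
        fun _ h5 => runs_copyCell hC0 hC (by simp) hc hi h5

theorem keptList_succ (m : Mem) (i : ℕ) :
    keptList m (i + 1) = keptList m i ++ if Kept m i then [i] else [] := by
  simp only [keptList, List.range_succ, List.filter_append, List.filter_singleton,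
    Bool.cond_decide]

theorem freedList_succ (m : Mem) (i : ℕ) :
    freedList m (i + 1) = freedList m i ++ if Freed m i then [i] else [] := by
  simp only [freedList, List.range_succ, List.filter_append, List.filter_singleton,
    Bool.cond_decide]

theorem length_keptList_le (m : Mem) (i : ℕ) : (keptList m i).length ≤ i :=
  (List.length_filter_le _ _).trans List.length_range.le

theorem length_freedList_le (m : Mem) (i : ℕ) : (freedList m i).length ≤ i :=
  (List.length_filter_le _ _).trans List.length_range.le

theorem runs_compactBody (hn : m₀ 0 = n) (hsmall : 2 * (n : ℤ) ≤ memBound b) (hi : i < n)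
    (h : CompactInv b m₀ i m) :
    Runs b compactBody m compactBody.cost (CompactInv b m₀ (i + 1)) := by
  have h0 : m 0 = m₀ 0 := h.frame 0 (by omega) (by omega) (by omega) (by omega)
  have h1 : m 1 = m₀ 1 := h.frame 1 (by omega) (by omega) (by omega) (by omega)
  have hw1 : m (-10 - 1 - 3 * (i : ℤ)) = m₀ (-10 - 1 - 3 * (i : ℤ)) :=
    h.frame _ (by omega) (by omega) (by omega) (by omega)
  have hw2 : m (-10 - 2 - 3 * (i : ℤ)) = m₀ (-10 - 2 - 3 * (i : ℤ)) :=
    h.frame _ (by omega) (by omega) (by omega) (by omega)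
  have hkl := length_keptList_le m₀ i
  have hfl := length_freedList_le m₀ i
  have hi' := h.i_eq
  have e1 : (hE + 1 - .load (arr 1 iE) : Expr).eval m =
      m₀ 0 - m₀ 1 + 1 - m₀ (-10 - 1 - 3 * (i : ℤ)) := by
    rw [← hw1, ← h0, ← h1]
    simp only [Expr.eval_sub, Expr.eval_add, Expr.eval_load, eval_hE, eval_arr, eval_iE, hi']
    rfl
  have e2 : (Expr.load (arr 2 iE)).eval m = m₀ (-10 - 2 - 3 * (i : ℤ)) := by
    rw [← hw2]
    simp only [Expr.eval_load, eval_arr, eval_iE, hi']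
  -- The state after the case distinction, before the index is increased.
  refine Runs.seq (Q := fun m' =>
    CompactInv b m₀ (i + 1) (Function.update m' (-1) ((i + 1 : ℕ) : ℤ)) ∧
      Bounded b m' ∧ m' (-1) = i) ?_ ?_
  swap
  · rintro m' ⟨hm', hb, him'⟩
    refine Runs.store hb (by decide) (by decide) ?_
    have hv : (iE + 1).eval m' = ((i + 1 : ℕ) : ℤ) := by simp [him']
    rwa [hv, Expr.eval_const]
  have habs : |((i + 1 : ℕ) : ℤ)| ≤ memBound b := by rw [abs_of_nonneg (by omega)]; omega
  refine Runs.ite h.bounded (by decide) (fun h3 => ?_) (fun h3 => Runs.skip ?_)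
  swap
  · rw [e1] at h3
    have hal : ¬ Alive 1 m₀ i := by simp only [Alive]; omega
    have hk : keptList m₀ (i + 1) = keptList m₀ i := by
      rw [keptList_succ, if_neg (fun hh => hal hh.1), List.append_nil]
    have hf : freedList m₀ (i + 1) = freedList m₀ i := by
      rw [freedList_succ, if_neg (fun hh => hal hh.1), List.append_nil]
    refine ⟨⟨h.bounded.update _ habs, by simp, ?_, ?_, ?_, ?_⟩, h.bounded, hi'⟩
    · rw [Function.update_of_ne (by omega), h.c_eq, hk]
    · rw [Function.update_of_ne (by omega), h.f_eq, hf]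
    · intro a a1 a4 a5 ha
      rw [Function.update_of_ne a1, h.frame a a1 a4 a5 (by omega)]
    · intro x hx q h2 h5
      rw [Function.update_of_ne (by omega)]
      simp only [hk] at hx ⊢
      exact h.cells x hx q h2 h5
  rw [e1] at h3
  have hal : Alive 1 m₀ i := by simp only [Alive]; omega
  refine Runs.ite h.bounded (by decide) (fun h4 => ?_) (fun h4 => ?_)
  · -- A point of the kernel.
    rw [e2] at h4
    have hK : Kept m₀ i := ⟨hal, h4⟩
    have hF : ¬ Freed m₀ i := fun hF => absurd hF.2 (by omega)
    have hk : keptList m₀ (i + 1) = keptList m₀ i ++ [i] := by rw [keptList_succ, if_pos hK]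
    have hf : freedList m₀ (i + 1) = freedList m₀ i := by
      rw [freedList_succ, if_neg hF, List.append_nil]
    refine Runs.seq (runs_copyPoint (C := (keptList m₀ i).length) (by omega) (by omega) h.bounded
      h.c_eq hi') ?_
    intro m' hm'
    refine Runs.store hm'.bounded (by decide) (by decide) ?_
    have hc' : m' (-4) = (keptList m₀ i).length := by rw [hm'.frame _ (by omega), h.c_eq]
    have hv : (cE + 1).eval m' = (((keptList m₀ i).length + 1 : ℕ) : ℤ) := by simp [hc']
    rw [hv, Expr.eval_const]
    have hb : Bounded b (Function.update m' (-4) (((keptList m₀ i).length + 1 : ℕ) : ℤ)) :=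
      hm'.bounded.update _ (by rw [abs_of_nonneg (by omega)]; omega)
    refine ⟨⟨hb.update _ habs, by simp, ?_, ?_, ?_, ?_⟩, hb, ?_⟩
    · rw [Function.update_of_ne (by omega), Function.update_self, hk, List.length_append,
        List.length_singleton]
    · rw [Function.update_of_ne (by omega), Function.update_of_ne (by omega),
        hm'.frame _ (by omega), h.f_eq, hf]
    · intro a a1 a4 a5 ha
      rw [Function.update_of_ne a1, Function.update_of_ne a4, hm'.frame _ (by omega),
        h.frame a a1 a4 a5 (by omega)]
    · intro x hx q h2 h5
      rw [Function.update_of_ne (by omega), Function.update_of_ne (by omega)]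
      simp only [hk] at hx ⊢
      rw [List.length_append, List.length_singleton] at hx
      by_cases hxl : x < (keptList m₀ i).length
      · rw [List.getElem_append_left hxl, hm'.frame _ (by omega), h.cells x hxl q h2 h5]
      · obtain rfl : x = (keptList m₀ i).length := by omega
        rw [hm'.cells q h2 (by omega), List.getElem_append_right (le_refl _)]
        simp only [Nat.sub_self, List.getElem_singleton]
        exact h.frame _ (by omega) (by omega) (by omega) (by omega)
    · rw [Function.update_of_ne (by omega), hm'.frame _ (by omega), hi']
  · -- A free point.
    rw [e2] at h4
    have hF : Freed m₀ i := ⟨hal, h4⟩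
    have hK : ¬ Kept m₀ i := fun hK => absurd hK.2 (by omega)
    have hk : keptList m₀ (i + 1) = keptList m₀ i := by
      rw [keptList_succ, if_neg hK, List.append_nil]
    have hf : freedList m₀ (i + 1) = freedList m₀ i ++ [i] := by rw [freedList_succ, if_pos hF]
    refine Runs.store h.bounded (by decide) (by decide) ?_
    have hv : (fE + 1).eval m = (((freedList m₀ i).length + 1 : ℕ) : ℤ) := by simp [h.f_eq]
    rw [hv, Expr.eval_const]
    have hb : Bounded b (Function.update m (-5) (((freedList m₀ i).length + 1 : ℕ) : ℤ)) :=
      h.bounded.update _ (by rw [abs_of_nonneg (by omega)]; omega)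
    refine ⟨⟨hb.update _ habs, by simp, ?_, ?_, ?_, ?_⟩, hb, ?_⟩
    · rw [Function.update_of_ne (by omega), Function.update_of_ne (by omega), h.c_eq, hk]
    · rw [Function.update_of_ne (by omega), Function.update_self, hf, List.length_append,
        List.length_singleton]
    · intro a a1 a4 a5 ha
      rw [Function.update_of_ne a1, Function.update_of_ne a5, h.frame a a1 a4 a5 (by omega)]
    · intro x hx q h2 h5
      rw [Function.update_of_ne (by omega), Function.update_of_ne (by omega)]
      simp only [hk] at hx ⊢
      exact h.cells x hx q h2 h5
    · rw [Function.update_of_ne (by omega), hi']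

/-- The running time of `compact`. -/
def compactTime (n : ℕ) : ℕ :=
  (Program.store (.const (-1)) 0).cost + (n + 1) * ((nE - iE).cost + 1 + compactBody.cost)

theorem runs_compact (hm : Bounded b m₀) (hn : m₀ 0 = n) (hsmall : 2 * (n : ℤ) ≤ memBound b)
    (h4 : m₀ (-4) = 0) (h5 : m₀ (-5) = 0) :
    Runs b compact m₀ (compactTime n) (CompactInv b m₀ n) := by
  refine Runs.seq (Q := CompactInv b m₀ 0) (Runs.store hm (by decide) (by decide) ?_) ?_
  · rw [Expr.eval_ofNat, Expr.eval_const]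
    refine ⟨hm.update _ (by have := sixteen_le_memBound b; simp; omega), by simp, ?_, ?_, ?_, ?_⟩
    · rw [Function.update_of_ne (by omega), h4]; simp [keptList]
    · rw [Function.update_of_ne (by omega), h5]; simp [freedList]
    · intro a a1 _ _ _
      rw [Function.update_of_ne a1]
    · intro x hx
      simp [keptList] at hx
  intro m hm'
  have hn' : ∀ i m', CompactInv b m₀ i m' → m' 0 = n := fun i m' h => by
    rw [h.frame 0 (by omega) (by omega) (by omega) (by omega), hn]
  refine Runs.loop (by decide) (fun _ _ h => h.bounded) ?_ ?_ hm'
  · intro i hi m' h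
    refine ⟨?_, runs_compactBody hn hsmall hi h⟩
    simp [hn' i m' h, h.i_eq]
    omega
  · intro m' h
    simp [hn' n m' h, h.i_eq]

end Compact

/-! ### The points in memory -/

/-- The point with index `i`. -/
def point (m : Mem) (i : ℕ) : ℚ × ℚ :=
  ((m (4 * (i : ℤ) + 2) : ℚ) / (m (4 * (i : ℤ) + 3) : ℚ),
    (m (4 * (i : ℤ) + 4) : ℚ) / (m (4 * (i : ℤ) + 5) : ℚ))

/-- The memory contains the points of `P`, with indices below `n`. -/
structure HasPoints (n : ℕ) (P : Finset (ℚ × ℚ)) (m : Mem) : Prop where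
  inj : ∀ i < n, ∀ j < n, point m i = point m j → i = j
  image : (Finset.range n).image (point m) = P
  pos : ∀ i < n, 0 < m (4 * (i : ℤ) + 3) ∧ 0 < m (4 * (i : ℤ) + 5)

section Points

variable {n : ℕ} {P : Finset (ℚ × ℚ)} {m m' : Mem}

theorem HasPoints.congr (h : HasPoints n P m)
    (he : ∀ a, 0 ≤ a → a < 4 * (n : ℤ) + 2 → m' a = m a) :
    HasPoints n P m' ∧ ∀ i < n, point m' i = point m i := by
  have hp : ∀ i < n, point m' i = point m i := fun i hi => by
    simp only [point, he (4 * (i : ℤ) + 2) (by omega) (by omega),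
      he (4 * (i : ℤ) + 3) (by omega) (by omega), he (4 * (i : ℤ) + 4) (by omega) (by omega),
      he (4 * (i : ℤ) + 5) (by omega) (by omega)]
  refine ⟨⟨fun i hi j hj hij => h.inj i hi j hj (by rwa [← hp i hi, ← hp j hj]), ?_, ?_⟩, hp⟩
  · rw [← h.image]
    exact Finset.image_congr fun i hi => hp i (Finset.mem_range.mp hi)
  · intro i hi
    rw [he (4 * (i : ℤ) + 3) (by omega) (by omega), he (4 * (i : ℤ) + 5) (by omega) (by omega)]
    exact h.pos i hi

theorem IsInput.hasPoints {k : ℕ} (h : IsInput m P k) :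
    HasPoints P.card P m ∧ m 0 = P.card ∧ m 1 = k := by
  obtain ⟨⟨L, hnd, rfl, h0, h1, hL⟩, -⟩ := h
  rw [List.toFinset_card_of_nodup hnd]
  have hp : ∀ (i : ℕ) (hi : i < L.length), point m i = L[i] := fun i hi => (hL i hi).2.2.symm
  refine ⟨⟨?_, ?_, fun i hi => ⟨(hL i hi).1, (hL i hi).2.1⟩⟩, h0, h1⟩
  · intro i hi j hj hij
    rw [hp i hi, hp j hj] at hij
    exact (hnd.getElem_inj_iff).mp hij
  · ext p
    simp only [Finset.mem_image, Finset.mem_range, List.mem_toFinset, List.mem_iff_getElem]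
    constructor
    · rintro ⟨i, hi, rfl⟩
      exact ⟨i, hi, (hp i hi).symm⟩
    · rintro ⟨i, hi, rfl⟩
      exact ⟨i, hi, hp i hi⟩

theorem HasPoints.slot_eq_iff (h : HasPoints n P m) {B : ℤ}
    (hnum : ∀ i j : ℕ, i < n → j < n → |slopeNum m i j| < B)
    (hden : ∀ i j : ℕ, i < n → j < n → |slopeDen m i j| < B) {i j j' : ℕ} (hi : i < n) (hj : j < n)
    (hj' : j' < n) : slot m B i j = slot m B i j' ↔
      dir (point m i) (point m j) = dir (point m i) (point m j') := by
  -- Numerator and denominator are the differences of the coordinates times a positive factor.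
  have hscale : ∀ x : ℕ, x < n → ∃ E : ℚ, 0 < E ∧
      (slopeNum m i x : ℚ) = ((point m x).2 - (point m i).2) * E ∧
      (slopeDen m i x : ℚ) = ((point m x).1 - (point m i).1) * E := by
    intro x hx
    obtain ⟨hi3, hi5⟩ := h.pos i hi
    obtain ⟨hx3, hx5⟩ := h.pos x hx
    have a1 : (0 : ℚ) < m (4 * (i : ℤ) + 3) := by exact_mod_cast hi3
    have a2 : (0 : ℚ) < m (4 * (i : ℤ) + 5) := by exact_mod_cast hi5
    have a3 : (0 : ℚ) < m (4 * (x : ℤ) + 3) := by exact_mod_cast hx3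
    have a4 : (0 : ℚ) < m (4 * (x : ℤ) + 5) := by exact_mod_cast hx5
    refine ⟨(m (4 * (i : ℤ) + 3) * m (4 * (i : ℤ) + 5) * (m (4 * (x : ℤ) + 3) * m (4 * (x : ℤ) + 5))
      : ℚ), by positivity, ?_, ?_⟩
    · simp only [slopeNum, point]
      push_cast
      field_simp
    · simp only [slopeDen, point]
      push_cast
      field_simp
  obtain ⟨E, hE, hU, hV⟩ := hscale j hj
  obtain ⟨E', hE', hU', hV'⟩ := hscale j' hj'
  have hV0 : slopeDen m i j = 0 ↔ (point m j).1 - (point m i).1 = 0 := by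
    rw [← Int.cast_eq_zero (α := ℚ), hV, mul_eq_zero_iff_right hE.ne']
  have hV0' : slopeDen m i j' = 0 ↔ (point m j').1 - (point m i).1 = 0 := by
    rw [← Int.cast_eq_zero (α := ℚ), hV', mul_eq_zero_iff_right hE'.ne']
  have hUV : slopeNum m i j * slopeDen m i j' = slopeNum m i j' * slopeDen m i j ↔
      ((point m j).2 - (point m i).2) * ((point m j').1 - (point m i).1) =
      ((point m j').2 - (point m i).2) * ((point m j).1 - (point m i).1) := by
    rw [← Int.cast_inj (α := ℚ)]
    push_cast
    rw [hU, hV, hU', hV']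
    constructor <;> intro hh
    · exact mul_right_cancel₀ (mul_pos hE hE').ne' (by linear_combination hh)
    · linear_combination (E * E') * hh
  rw [slot, slot, add_right_inj, slopeKey_eq_iff (hnum i j hi hj) (hnum i j' hi hj')
    (hden i j hi hj) (hden i j' hi hj'), Ne, Ne, hV0, hV0', hUV, dir, dir]
  by_cases h1 : (point m j).1 - (point m i).1 = 0 <;>
    by_cases h2 : (point m j').1 - (point m i).1 = 0
  · simp [h1, h2]
  · simp [h1, h2]
  · simp [h1, h2]
  · simp only [h1, h2, if_false, Option.some.injEq, div_eq_div_iff h1 h2]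
    simp

theorem card_image_eq_of_eq_iff {α β γ : Type*} [DecidableEq β] [DecidableEq γ] (s : Finset α)
    (f : α → β) (g : α → γ) (h : ∀ x ∈ s, ∀ y ∈ s, f x = f y ↔ g x = g y) :
    (s.image f).card = (s.image g).card := by
  refine Finset.card_bij' (fun b hb => g (Finset.mem_image.mp hb).choose)
    (fun c hc => f (Finset.mem_image.mp hc).choose) ?_ ?_ ?_ ?_
  · intro b hb
    exact Finset.mem_image_of_mem _ (Finset.mem_image.mp hb).choose_spec.1
  · intro c hc
    exact Finset.mem_image_of_mem _ (Finset.mem_image.mp hc).choose_spec.1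
  · intro b hb
    have h1 := (Finset.mem_image.mp hb).choose_spec
    have hc := Finset.mem_image_of_mem g h1.1
    have h2 := (Finset.mem_image.mp hc).choose_spec
    exact ((h _ h2.1 _ h1.1).mpr h2.2).trans h1.2
  · intro c hc
    have h1 := (Finset.mem_image.mp hc).choose_spec
    have hb := Finset.mem_image_of_mem f h1.1
    have h2 := (Finset.mem_image.mp hb).choose_spec
    exact ((h _ h2.1 _ h1.1).mp h2.2).trans h1.2

/-- The numbers that a scan computes are the weights with respect to the points that take part. -/
theorem HasPoints.repeats_eq_weight (h : HasPoints n P m) {B t : ℤ}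
    (hnum : ∀ i j : ℕ, i < n → j < n → |slopeNum m i j| < B)
    (hden : ∀ i j : ℕ, i < n → j < n → |slopeDen m i j| < B) {i : ℕ} (hi : i < n)
    {Q : Finset (ℚ × ℚ)} (hQP : Q ⊆ P) (hQ : ∀ j < n, Alive t m j ↔ point m j ∈ Q) :
    repeats B t m i n = weight Q (point m i) := by
  have hlt : ∀ j ∈ row t m i n, j < n := fun j hj =>
    Finset.mem_range.mp (Finset.mem_filter.mp hj).1
  have hrow : (row t m i n).image (point m) = Q.erase (point m i) := by
    ext p
    simp only [row, Finset.mem_image, Finset.mem_filter, Finset.mem_range, Finset.mem_erase]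
    constructor
    · rintro ⟨j, ⟨hj, hal, hji⟩, rfl⟩
      exact ⟨fun hh => hji (h.inj j hj i hi hh), (hQ j hj).mp hal⟩
    · rintro ⟨hp, hpQ⟩
      have hpP := hQP hpQ
      rw [← h.image, Finset.mem_image] at hpP
      obtain ⟨j, hj, rfl⟩ := hpP
      rw [Finset.mem_range] at hj
      exact ⟨j, ⟨hj, (hQ j hj).mpr hpQ, fun hji => hp (by rw [hji])⟩, rfl⟩
  have hcard : (row t m i n).card = (Q.erase (point m i)).card := by
    rw [← hrow, Finset.card_image_of_injOn]
    exact fun x hx y hy hxy => h.inj x (hlt x hx) y (hlt y hy) hxy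
  rw [repeats, weight, hcard, ← hrow, Finset.image_image, slots]
  congr 1
  exact card_image_eq_of_eq_iff _ _ _ fun x hx y hy =>
    h.slot_eq_iff hnum hden hi (hlt x hx) (hlt y hy)

theorem HasPoints.filter_list (h : HasPoints n P m) {Q : Finset (ℚ × ℚ)} (hQP : Q ⊆ P)
    {p : ℕ → Prop} [DecidablePred p] (hp : ∀ j < n, p j ↔ point m j ∈ Q) :
    (((List.range n).filter p).map (point m)).Nodup ∧
      (((List.range n).filter p).map (point m)).toFinset = Q ∧
      ((List.range n).filter p).length = Q.card := by
  have h1 : (((List.range n).filter p).map (point m)).Nodup := by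
    refine List.Nodup.map_on ?_ (List.nodup_range.filter _)
    intro x hx y hy hxy
    rw [List.mem_filter, List.mem_range] at hx hy
    exact h.inj x hx.1 y hy.1 hxy
  have h2 : (((List.range n).filter p).map (point m)).toFinset = Q := by
    ext q
    simp only [List.mem_toFinset, List.mem_map, List.mem_filter, List.mem_range, decide_eq_true_eq]
    constructor
    · rintro ⟨j, ⟨hj, hpj⟩, rfl⟩
      exact (hp j hj).mp hpj
    · intro hq
      have hqP := hQP hq
      rw [← h.image, Finset.mem_image] at hqP
      obtain ⟨j, hj, rfl⟩ := hqP
      rw [Finset.mem_range] at hj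
      exact ⟨j, ⟨hj, (hp j hj).mpr hq⟩, rfl⟩
  refine ⟨h1, h2, ?_⟩
  rw [← h2, List.toFinset_card_of_nodup h1, List.length_map]

end Points

/-! ### The kernelization -/

/-- Writes the no-instance without points and with `k = 1`. -/
def reject : Program := .seq (.store 0 0) (.store 1 1)

/-- Writes the sizes of the kernel if they are in range, and a no-instance otherwise. -/
def finish : Program :=
  .ite (cE - (2 * (hE * hE) + hE)) reject
    (.ite (kE - fE - cE) reject
      (.seq (.ite (kE - fE) (.store 1 (kE - fE)) (.store 1 0)) (.store 0 cE)))

/-- The kernelization. Its output is a fixed no-instance if `k` exceeds the number of points. -/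
def kernelize : Program :=
  .ite (kE - nE) reject
    (.seq computeBound (.seq (scan 0) (.seq (scan 1) (.seq compact finish))))

/-- The outcome of the program, as required of a kernelization. -/
def IsKernel (P : Finset (ℚ × ℚ)) (k : ℕ) (m : Mem) : Prop :=
  ∃ (P' : Finset (ℚ × ℚ)) (k' : ℕ), Encodes m P' k' ∧ P' ⊆ P ∧
    (P'.card : ℤ) ≤ 2 * dualParam P k ^ 2 + dualParam P k ∧
    (k' : ℤ) ≤ 2 * dualParam P k ^ 2 + dualParam P k + 1 ∧ (IsYes P k ↔ IsYes P' k')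

theorem IsYes.le_card {P : Finset (ℚ × ℚ)} {k : ℕ} (h : IsYes P k) : k ≤ P.card := by
  obtain ⟨S, hSP, -, hk⟩ := h
  exact hk.trans (Finset.card_le_card hSP)

theorem runs_reject {b : ℕ} {m : Mem} {P : Finset (ℚ × ℚ)} {k : ℕ} (hm : Bounded b m)
    (hno : ¬ IsYes P k) : Runs b reject m reject.cost (IsKernel P k) := by
  have hle : 0 ≤ 2 * dualParam P k ^ 2 + dualParam P k := by
    nlinarith [Int.le_self_sq (-dualParam P k), sq_nonneg (dualParam P k)]
  have h16 := sixteen_le_memBound b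
  have hb : Bounded b (Function.update m 0 0) := hm.update _ (by simp; omega)
  refine Runs.seq (Q := fun m' => m' = Function.update m 0 0)
    (Runs.store hm (by decide) (by decide) rfl) ?_
  rintro _ rfl
  refine Runs.store hb (by decide) (by decide) ?_
  simp only [Expr.eval_ofNat]
  refine ⟨∅, 1, ⟨[], List.nodup_nil, rfl, by simp, by simp, by simp⟩, Finset.empty_subset _,
    by simpa using hle, by push_cast; omega, iff_of_false hno fun h => ?_⟩
  have := h.le_card
  simp at this

/-- When `m₀` holds the points with their weights in both rounds, the compacted memory leads to a
kernel. -/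
theorem runs_finish {b n : ℕ} {m₀ m : Mem} {P : Finset (ℚ × ℚ)} {k : ℕ} (hP : HasPoints n P m₀)
    (hn : m₀ 0 = n) (hcard : P.card = n) (hk : m₀ 1 = k) (hm : CompactInv b m₀ n m)
    (hsmall : 2 * (n : ℤ) ≤ memBound b)
    (hkept : ∀ j < n, Kept m₀ j ↔ point m₀ j ∈ core (light P (dualParam P k)))
    (hfreed : ∀ j < n, Freed m₀ j ↔ point m₀ j ∈ free (light P (dualParam P k))) :
    Runs b finish m finish.cost (IsKernel P k) := by
  set Q := light P (dualParam P k) with hQ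
  have hQP : Q ⊆ P := Finset.filter_subset _ _
  have hCP : core Q ⊆ P := (Finset.filter_subset _ _).trans hQP
  obtain ⟨hnd, hset, hlen⟩ := hP.filter_list hCP hkept
  have hFP : free Q ⊆ P := (Finset.filter_subset _ _).trans hQP
  obtain ⟨-, -, hlenF⟩ := hP.filter_list hFP hfreed
  have h0 : m 0 = n := by rw [hm.frame 0 (by omega) (by omega) (by omega) (by omega), hn]
  have h1 : m 1 = k := by rw [hm.frame 1 (by omega) (by omega) (by omega) (by omega), hk]
  have hc : m (-4) = (core Q).card := by rw [hm.c_eq, keptList, hlen]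
  have hf : m (-5) = (free Q).card := by rw [hm.f_eq, freedList, hlenF]
  have hh : m 0 - m 1 = dualParam P k := by rw [h0, h1, dualParam, hcard]
  have hyes : IsYes P k ↔ IsYes (core Q) (k - (free Q).card) :=
    (isYes_light_iff P k).trans (isYes_core_iff Q k)
  have hle : IsYes (core Q) (k - (free Q).card) →
      ((core Q).card : ℤ) ≤ 2 * dualParam P k ^ 2 + dualParam P k := card_core_le
  have hCc : (core Q).card ≤ n := hcard ▸ Finset.card_le_card hCP
  refine Runs.ite hm.bounded (by decide) (fun h2 => ?_) (fun h2 => ?_)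
  · refine runs_reject hm.bounded fun h3 => ?_
    have h4 := hle (hyes.mp h3)
    simp only [Expr.eval_sub, Expr.eval_add, Expr.eval_mul, Expr.eval_ofNat, eval_cE, eval_hE, hc,
      hh] at h2
    rw [pow_two] at h4
    omega
  simp only [Expr.eval_sub, Expr.eval_add, Expr.eval_mul, Expr.eval_ofNat, eval_cE, eval_hE, hc,
    hh, ← pow_two] at h2
  refine Runs.ite hm.bounded (by decide) (fun h3 => ?_) (fun h3 => ?_)
  · refine runs_reject hm.bounded fun h4 => ?_
    have h5 := (hyes.mp h4).le_card
    simp only [Expr.eval_sub, eval_kE, eval_fE, eval_cE, hc, hf, h1] at h3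
    omega
  simp only [Expr.eval_sub, eval_kE, eval_fE, eval_cE, hc, hf, h1] at h3
  -- Both outcomes of the comparison store the truncated difference.
  refine Runs.seq (Q := fun m' => m' = Function.update m 1 ((k - (free Q).card : ℕ) : ℤ))
    (Runs.ite hm.bounded (by decide)
      (fun h4 => Runs.store hm.bounded (by decide) (by decide) ?_)
      (fun h4 => Runs.store hm.bounded (by decide) (by decide) ?_)) ?_
  · simp only [Expr.eval_sub, eval_kE, eval_fE, hf, h1, Expr.eval_ofNat] at h4 ⊢
    congr 1
    omega
  · simp only [Expr.eval_sub, eval_kE, eval_fE, hf, h1, Expr.eval_ofNat] at h4 ⊢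
    congr 1
    omega
  rintro _ rfl
  refine Runs.store (hm.bounded.update _ ?_) (by decide) (by decide) ?_
  · rw [abs_of_nonneg (by omega)]
    omega
  rw [Expr.eval_ofNat, eval_cE, Function.update_of_ne (by omega), hc]
  refine ⟨core Q, k - (free Q).card, ⟨(keptList m₀ n).map (point m₀), hnd, hset, ?_, by simp, ?_⟩,
    hCP, by omega, by omega, hyes⟩
  · rw [List.length_map, keptList, hlen, Function.update_self]
  · intro x hx
    rw [List.length_map] at hx
    have hlt : (keptList m₀ n)[x] < n := by
      have h6 : (keptList m₀ n)[x] ∈ (List.range n).filter (fun j => Kept m₀ j) :=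
        List.getElem_mem hx
      exact List.mem_range.mp (List.mem_filter.mp h6).1
    have e : ∀ q : ℤ, 2 ≤ q → q ≤ 5 →
        Function.update (Function.update m 1 ((k - (free Q).card : ℕ) : ℤ)) 0 ((core Q).card : ℤ)
          (4 * (x : ℤ) + q) = m₀ (4 * ((keptList m₀ n)[x] : ℕ) + q) := by
      intro q h2 h5
      rw [Function.update_of_ne (by omega), Function.update_of_ne (by omega), hm.cells x hx q h2 h5]
    simp only [e 2 (by omega) (by omega), e 3 (by omega) (by omega), e 4 (by omega) (by omega),
      e 5 (by omega) (by omega), List.getElem_map]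
    exact ⟨(hP.pos _ hlt).1, (hP.pos _ hlt).2, rfl⟩

/-- The running time of `kernelize`. -/
def totalTime (n : ℕ) : ℕ :=
  (kE - nE).cost + 1 + max reject.cost
    ((4 * n + 1) * ((4 * nE - iE).cost + 1 + sumBody.cost) +
      (Program.store (.const (-3))
        (2 * ((bE + nE + 1) * (bE + nE + 1) * (bE + nE + 1) * (bE + nE + 1)) + 1)).cost +
      (scanTime 0 n + (scanTime 1 n + (compactTime n + finish.cost))))

theorem exists_totalTime_le : ∃ T : ℕ, ∀ n, totalTime n ≤ T * (n ^ 2 + 1) := by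
  have hscan : ∀ t : ℤ, ∃ K : ℕ, ∀ n, scanTime t n ≤ K * (n ^ 2 + 1) := by
    intro t
    unfold scanTime rowTime
    generalize (Program.store (.const (-1)) 0).cost = c₁
    generalize (nE - iE).cost = c₂
    generalize (Program.store (.const (-2)) 0).cost = c₃
    generalize (nE - jE).cost + 1 + (scanBody t).cost = c₄
    generalize (Program.store (.const (-1)) (iE + 1)).cost = c₅
    refine ⟨c₁ + 2 * (c₂ + 1 + c₃ + c₅) + 2 * c₄, fun n => ?_⟩
    have h1 : n + 1 ≤ 2 * (n ^ 2 + 1) := by nlinarith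
    have h2 : (n + 1) * (n + 1) ≤ 2 * (n ^ 2 + 1) := by nlinarith [sq_nonneg ((n : ℤ) - 1)]
    calc c₁ + (n + 1) * (c₂ + 1 + (c₃ + ((n + 1) * c₄ + c₅)))
        = c₁ * 1 + (n + 1) * (c₂ + 1 + c₃ + c₅) + (n + 1) * (n + 1) * c₄ := by ring
      _ ≤ c₁ * (n ^ 2 + 1) + 2 * (n ^ 2 + 1) * (c₂ + 1 + c₃ + c₅) + 2 * (n ^ 2 + 1) * c₄ := by
          gcongr
          omega
      _ = _ := by ring
  obtain ⟨K₀, hK₀⟩ := hscan 0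
  obtain ⟨K₁, hK₁⟩ := hscan 1
  unfold totalTime compactTime
  generalize (kE - nE).cost = c₁
  generalize reject.cost = c₂
  generalize (4 * nE - iE).cost + 1 + sumBody.cost = c₃
  generalize (Program.store (.const (-3)) _).cost = c₄
  generalize (Program.store (.const (-1)) 0).cost = c₅
  generalize (nE - iE).cost + 1 + compactBody.cost = c₆
  generalize finish.cost = c₇
  refine ⟨c₁ + 1 + c₂ + 8 * c₃ + c₄ + K₀ + K₁ + c₅ + 2 * c₆ + c₇, fun n => ?_⟩
  have h1 : n + 1 ≤ 2 * (n ^ 2 + 1) := by nlinarith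
  have h2 : 4 * n + 1 ≤ 8 * (n ^ 2 + 1) := by nlinarith
  have h3 : 1 ≤ n ^ 2 + 1 := by omega
  have h4 := Nat.mul_le_mul_right c₃ h2
  have h5 := Nat.mul_le_mul_right c₆ h1
  have h6 := Nat.mul_le_mul_left (c₁ + 1 + c₂ + c₄ + c₅ + c₇) h3
  have h7 := hK₀ n
  have h8 := hK₁ n
  have h9 : max c₂ ((4 * n + 1) * c₃ + c₄ + (scanTime 0 n + (scanTime 1 n +
      (c₅ + (n + 1) * c₆ + c₇)))) ≤ c₂ + ((4 * n + 1) * c₃ + c₄ + (scanTime 0 n + (scanTime 1 n +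
      (c₅ + (n + 1) * c₆ + c₇)))) := max_le (Nat.le_add_right _ _) (Nat.le_add_left _ _)
  nlinarith

theorem runs_kernelize {b k : ℕ} {P : Finset (ℚ × ℚ)} {m₀ : Mem} (hin : IsInput m₀ P k)
    (hfit : ∀ a, FitsWord b (m₀ a)) :
    Runs b kernelize m₀ (totalTime P.card) (IsKernel P k) := by
  obtain ⟨hP, hn, hk⟩ := hin.hasPoints
  have hzero := hin.2
  set n := P.card with hcard
  have hb : Bounded b m₀ := fun a =>
    (hfit a).le.trans (pow_le_pow_right₀ (by norm_num) (by omega))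
  have hsmall : 2 * (n : ℤ) ≤ memBound b := by
    have h1 := hfit 0
    have h2 : (2 : ℤ) * 2 ^ b ≤ memBound b := by
      rw [← pow_succ']
      exact pow_le_pow_right₀ (by norm_num) (by omega)
    rw [hn, FitsWord, Nat.abs_cast] at h1
    omega
  refine Runs.ite hb (by decide) (fun h => runs_reject hb fun hyes => ?_) (fun h => ?_)
  · have := hyes.le_card
    simp [hn, hk] at h
    omega
  have hh : m₀ 0 - m₀ 1 = dualParam P k := by rw [hn, hk, dualParam]
  have hh0 : 0 ≤ dualParam P k := by
    simp [hn, hk] at h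
    rw [dualParam]
    omega
  refine Runs.seq (runs_computeBound hfit hn (hzero _ (by omega)) (hzero _ (by omega))) ?_
  rintro m₁ ⟨hb₁, hB₁, hf₁⟩
  set B := slopeBound m₀ n
  have hin₁ : ∀ a, 0 ≤ a → a < 4 * (n : ℤ) + 2 → m₁ a = m₀ a := fun a h0 _ =>
    hf₁ a (by omega) (by omega)
  obtain ⟨hP₁, hpt₁⟩ := hP.congr hin₁
  -- The bound on slopes only depends on the input cells.
  have hslope : ∀ m : Mem, (∀ a, 0 ≤ a → a < 4 * (n : ℤ) + 2 → m a = m₀ a) → ∀ i j : ℕ, i < n →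
      j < n → |slopeNum m i j| < B ∧ |slopeDen m i j| < B := by
    intro m hm i j hi hj
    have e : ∀ x : ℕ, x < n → ∀ q : ℤ, 2 ≤ q → q ≤ 5 → m (4 * x + q) = m₀ (4 * x + q) :=
      fun x hx q h2 h5 => hm _ (by omega) (by omega)
    have := abs_slope_lt m₀ hi hj
    simpa only [slopeNum, slopeDen, e i hi 2 (by omega) (by omega), e i hi 3 (by omega) (by omega),
      e i hi 4 (by omega) (by omega), e i hi 5 (by omega) (by omega),
      e j hj 2 (by omega) (by omega), e j hj 3 (by omega) (by omega),
      e j hj 4 (by omega) (by omega), e j hj 5 (by omega) (by omega)] using this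
  have hs₁ := hslope m₁ hin₁
  have hz₁ : ∀ a, a ≤ -10 ∨ 4 * (n : ℤ) + 2 ≤ a → m₁ a = 0 := fun a ha => by
    rw [hf₁ a (by omega) (by omega), hzero a (by omega)]
  have h0₁ : m₁ 0 = n := by rw [hin₁ 0 (by omega) (by omega), hn]
  have h1₁ : m₁ 1 = k := by rw [hin₁ 1 (by omega) (by omega), hk]
  have hscan₀ : ScanInput b n B 0 m₁ :=
    ⟨Or.inl rfl, hb₁, h0₁, hB₁, hsmall, fun i j hi hj => (hs₁ i j hi hj).1,
      fun x => hz₁ _ (by omega), fun a ha => by rw [hz₁ a (Or.inr ha)]; omega⟩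
  refine Runs.seq (runs_scan hscan₀) ?_
  intro m₂ hm₂
  have hin₂ : ∀ a, 0 ≤ a → a < 4 * (n : ℤ) + 2 → m₂ a = m₁ a := fun a h0 h1 =>
    hm₂.frame.input (Or.inl rfl) (by omega) (by omega) (by omega) h1
  obtain ⟨hP₂, hpt₂⟩ := hP₁.congr hin₂
  have h0₂ : m₂ 0 = n := by rw [hin₂ 0 (by omega) (by omega), h0₁]
  have h1₂ : m₂ 1 = k := by rw [hin₂ 1 (by omega) (by omega), h1₁]
  have hs₂ := hslope m₂ fun a h0 h1 => (hin₂ a h0 h1).trans (hin₁ a h0 h1)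
  -- In the first scan, all points take part.
  have hw₂ : ∀ j < n, m₂ (-10 - 1 - 3 * (j : ℤ)) = weight P (point m₁ j) := by
    intro j hj
    have := hm₂.dst j
    rw [if_pos hj, hP₁.repeats_eq_weight (fun i j hi hj => (hs₁ i j hi hj).1)
      (fun i j hi hj => (hs₁ i j hi hj).2) hj (Q := P) subset_rfl] at this
    · exact this
    · intro x hx
      refine iff_of_true ?_ ?_
      · rw [Alive, hz₁ _ (by omega), h0₁, h1₁]
        rw [dualParam] at hh0
        omega
      · rw [← hP₁.image]
        exact Finset.mem_image_of_mem _ (Finset.mem_range.mpr hx)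
  set Q := light P (dualParam P k) with hQ
  have hQP : Q ⊆ P := Finset.filter_subset _ _
  have hscan₁ : ScanInput b n B 1 m₂ := by
    refine ⟨Or.inr rfl, hm₂.bounded, h0₂, ?_, hsmall, fun i j hi hj => (hs₂ i j hi hj).1, ?_, ?_⟩
    · rw [hm₂.frame.input (Or.inl rfl) (by omega) (by omega) (by omega) (by omega), hB₁]
    · intro x
      rw [hm₂.frame _ (by omega) (by omega) (by omega) (fun y => by omega), hz₁ _ (by omega)]
    · intro a ha
      have := hm₂.table a ha
      omega
  have halive₂ : ∀ j < n, Alive 1 m₂ j ↔ point m₂ j ∈ Q := by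
    intro j hj
    have hjP : point m₁ j ∈ P := by
      rw [← hP₁.image]
      exact Finset.mem_image_of_mem _ (Finset.mem_range.mpr hj)
    rw [Alive, hw₂ j hj, h0₂, h1₂, hpt₂ j hj, hQ, light, Finset.mem_filter, dualParam]
    simp [hjP, hcard]
  refine Runs.seq (runs_scan hscan₁) ?_
  intro m₃ hm₃
  have hin₃ : ∀ a, 0 ≤ a → a < 4 * (n : ℤ) + 2 → m₃ a = m₂ a := fun a h0 h1 =>
    hm₃.frame.input (Or.inr rfl) (by omega) (by omega) (by omega) h1
  obtain ⟨hP₃, hpt₃⟩ := hP₂.congr hin₃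
  have h0₃ : m₃ 0 = n := by rw [hin₃ 0 (by omega) (by omega), h0₂]
  have h1₃ : m₃ 1 = k := by rw [hin₃ 1 (by omega) (by omega), h1₂]
  have hw₃ : ∀ j < n, m₃ (-10 - 2 - 3 * (j : ℤ)) = weight Q (point m₃ j) := by
    intro j hj
    have := hm₃.dst j
    rw [if_pos hj, hP₂.repeats_eq_weight (fun i j hi hj => (hs₂ i j hi hj).1)
      (fun i j hi hj => (hs₂ i j hi hj).2) hj hQP halive₂] at this
    rw [hpt₃ j hj]
    exact this
  have halive₃ : ∀ j < n, Alive 1 m₃ j ↔ point m₃ j ∈ Q := by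
    intro j hj
    rw [hpt₃ j hj, ← halive₂ j hj, Alive, Alive, h0₃, h1₃, h0₂, h1₂,
      hm₃.frame _ (by omega) (by omega) (by omega) (fun y => by omega)]
  have hreg : ∀ a : ℤ, a = -4 ∨ a = -5 → m₃ a = 0 := by
    intro a ha
    rw [hm₃.frame.input (Or.inr rfl) (by omega) (by omega) (by omega) (by omega),
      hm₂.frame.input (Or.inl rfl) (by omega) (by omega) (by omega) (by omega),
      hf₁ a (by omega) (by omega), hzero a (by omega)]
  refine Runs.seq (runs_compact hm₃.bounded h0₃ hsmall (hreg _ (by simp)) (hreg _ (by simp))) ?_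
  intro m₄ hm₄
  refine runs_finish hP₃ h0₃ hcard.symm h1₃ hm₄ hsmall ?_ ?_
  · intro j hj
    rw [Kept, halive₃ j hj, hw₃ j hj, core, Finset.mem_filter, Int.natCast_pos]
  · intro j hj
    change _ ↔ point m₃ j ∈ free Q
    rw [Freed, halive₃ j hj, hw₃ j hj, free, Finset.mem_filter]
    simp

end GPSS

theorem mainTheorem2 :
    ∃ (prog : GPSS.Program) (T W : ℕ),
      ∀ (P : Finset (ℚ × ℚ)) (k : ℕ) (m : GPSS.Mem) (b : ℕ),
        GPSS.IsInput m P k → (∀ a : ℤ, GPSS.FitsWord b (m a)) →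
        ∃ (P' : Finset (ℚ × ℚ)) (k' : ℕ) (t : ℕ) (m' : GPSS.Mem),
          GPSS.Exec (W * (b + 1)) prog m t m' ∧
          t ≤ T * (P.card ^ 2 + 1) ∧
          GPSS.Encodes m' P' k' ∧
          P' ⊆ P ∧
          (P'.card : ℤ) ≤ 2 * GPSS.dualParam P k ^ 2 + GPSS.dualParam P k ∧
          (k' : ℤ) ≤ 2 * GPSS.dualParam P k ^ 2 + GPSS.dualParam P k + 1 ∧
          (GPSS.IsYes P k ↔ GPSS.IsYes P' k') := by
  obtain ⟨T, hT⟩ := GPSS.exists_totalTime_le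
  refine ⟨GPSS.kernelize, T, GPSS.wordFactor, fun P k m b hin hfit => ?_⟩
  obtain ⟨t, m', hexec, ht, P', k', h1, h2, h3, h4, h5⟩ := GPSS.runs_kernelize hin hfit
  exact ⟨P', k', t, m', hexec, ht.trans (hT _), h1, h2, h3, h4, h5⟩
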